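/- Let $\mathcal X=\{0,\dots,|\mathcal X|-1\}$, $\mathcal Y_0=\{0,\dots,|\mathcal Y_0|-1\}$, $\mathcal Y=\{0,\dots,|\mathcal Y|-1\}$ and $\mathcal Z=\{0,\dots,|\mathcal Z|-1\}$ be non-empty finite alphabets. Let $(N_0(i))_i,(N_1(i))_i,(N_2(i))_i$ be random noise sequences with values in $\mathcal Y_0,\mathcal Y,\mathcal Z$ respectively. The sequences $(N_1(i))_i$ and $(N_2(i))_i$ are each i.i.d., and the three sequences may be mutually dependent, except that the main channel is memoryless: for each $i$, $N_1(i)$ is independent of the past $(N_0(j),N_1(j))_{j<i}$. (This holds in particular if the triples $(N_0(i),N_1(i),N_2(i))$ are i.i.d. with an arbitrary joint law.) In the discrete memoryless modulo-additive wiretap channel with full-duplex noisy feedback, at time $i$ the source sends $X(i)\in\mathcal X$, the destination sends $X_1(i)$, and the source, the destination and the wiretapper receive $$Y_0(i)=X(i)+X_1(i)+N_0(i)\bmod|\mathcal Y_0|,\quad Y(i)=X(i)+X_1(i)+N_1(i)\bmod|\mathcal Y|,\quad Z(i)=X(i)+X_1(i)+N_2(i)\bmod|\mathcal Z| .$$ An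 $(M,n)$ code consists of a causal stochastic encoder giving $X(i)$ as a function of $i$, the message $W$, the past $Y_0^{i-1}$ and private randomness of the source; a finite feedback alphabet $\mathcal X_1=\{0,\dots,|\mathcal X_1|-1\}$ and a causal stochastic feedback map giving $X_1(i)\in\mathcal X_1$ as a function of $i$, the past $Y^{i-1}$ and private randomness of the destination; and a decoder that estimates $W$ from $Y^n$ and the destination's own feedback $X_1^n$. Here $W$ is uniform on $M\ge1$ values, and $W$, the two private sources of randomness and the noise are independent. A secrecy rate $R\in\mathbb R$ is achievable if for every $\epsilon>0$ there is $n(\epsilon)$ such that for every $n\ge n(\epsilon)$ there is an $(M,n)$ code with $$\Big|\tfrac1n\log_2M-R\Big|\le\epsilon,\qquad P_e^n\le\epsilon,\qquad \tfrac1nH(W\mid Z^n)\ge R-\epsilon,$$ where $P_e^n$ is the average probability of error and entropies are in bits. The secrecy capacity with noisy feedback $C_s^f$ is the supremum of the achievable secrecy rates. Then $$C_s^f=C,$$ where $C$ is the capacity of the main channel $Y=X+N_1\bmod|\mathcal Y|$ in the absence of the wiretapper, that is, $C=\max_{P_X}I(X;Y)$, which is also the supremum of the rates $R$ that are achievable over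 the main channel by ordinary codes without feedback (for every $\epsilon>0$ and all sufficiently large $n$ there is a codebook of $M\ge1$ codewords in $\mathcal X^n$ and a decoder with $|\frac1n\log_2M-R|\le\epsilon$ and $P_e^n\le\epsilon$). -/

import Mathlib

open MeasureTheory ProbabilityTheory

namespace ModWiretap

noncomputable section

/-- The modulo-additive channel law: the output of a channel with alphabet `{0, …, q - 1}` when the
transmitted integers add up to `m` and the noise sample is `v`, namely `(m + v) mod q`. -/
def modAdd {q : ℕ} (m : ℕ) (v : Fin q) : Fin q :=
  ⟨(m + v) % q, Nat.mod_lt _ v.pos⟩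

/-- The conditional entropy `H(A | B)`, in bits, of a pair with joint mass function `p`. A term with
`p a b = 0` contributes `0`. -/
def condEntropy {α β : Type*} [Fintype α] [Fintype β] (p : α → β → ℝ) : ℝ :=
  ∑ b, ∑ a, p a b * Real.logb 2 ((∑ a', p a' b) / p a b)

/-- The mutual information `I(X; Y)`, in bits, for the input mass function `p` and the transition
probabilities `V x y` of `y` given `x`. A term with `p x = 0` or `V x y = 0` contributes `0`. -/
def mutualInfo {α β : Type*} [Fintype α] [Fintype β] (p : α → ℝ) (V : α → β → ℝ) : ℝ :=
  ∑ x, ∑ y, p x * V x y * Real.logb 2 (V x y / ∑ x', p x' * V x' y)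

/-- An `(M, n)` code with causal noisy feedback, for the source alphabet `{0, …, a - 1}`, the
alphabet `{0, …, q₀ - 1}` of the signal heard by the source, and the alphabet `{0, …, q₁ - 1}` of
the signal heard by the destination.

The stochastic maps of the two terminals are written as functions of private randomness: `s : S` is
known only to the source and `u : U` only to the destination. The feedback alphabet
`{0, …, k - 1}` is part of the code. Time starts at `0`, and only the times `i < n` are used. -/
structure Code (a q₀ q₁ n M : ℕ) where
  /-- The private randomness of the source. -/
  S : Type
  [measS : MeasurableSpace S]
  /-- The law of the private randomness of the source. -/
  lawS : Measure S
  [probS : IsProbabilityMeasure lawS]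
  /-- The private randomness of the destination. -/
  U : Type
  [measU : MeasurableSpace U]
  /-- The law of the private randomness of the destination. -/
  lawU : Measure U
  [probU : IsProbabilityMeasure lawU]
  /-- The size of the feedback alphabet. -/
  k : ℕ
  /-- The source encoder: time, message, private randomness, signal heard by the source so far. -/
  enc : (i : ℕ) → Fin M → S → (Fin i → Fin q₀) → Fin a
  enc_meas : ∀ i w y, Measurable fun s => enc i w s y
  /-- The feedback encoder: time, private randomness, signal received by the destination so far. -/
  fb : (i : ℕ) → U → (Fin i → Fin q₁) → Fin k
  fb_meas : ∀ i y, Measurable fun u => fb i u y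
  /-- The decoder of the destination, which knows what it received and what it fed back. -/
  dec : (Fin n → Fin q₁) → (Fin n → Fin k) → Fin M

attribute [instance] Code.measS Code.probS Code.measU Code.probU

namespace Code

variable {a q₀ q₁ q₂ n M : ℕ}

/-- The symbols `(x(i), x₁(i))` sent at time `i` by the source and by the destination, when the
message is `w`, the private randomness is `s`, `u` and the noise samples are `n₀`, `n₁`. The source
has heard `y₀(j) = x(j) + x₁(j) + n₀(j)` and the destination `y(j) = x(j) + x₁(j) + n₁(j)` at the
times `j < i`. -/
def sent (c : Code a q₀ q₁ n M) (w : Fin M) (s : c.S) (u : c.U)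
    (n₀ : ℕ → Fin q₀) (n₁ : ℕ → Fin q₁) (i : ℕ) : Fin a × Fin c.k :=
  (c.enc i w s fun j : Fin i =>
      modAdd ((sent c w s u n₀ n₁ j).1 + (sent c w s u n₀ n₁ j).2) (n₀ j),
    c.fb i u fun j : Fin i =>
      modAdd ((sent c w s u n₀ n₁ j).1 + (sent c w s u n₀ n₁ j).2) (n₁ j))
termination_by i
decreasing_by all_goals exact j.2

/-- What a receiver with the noise samples `v` receives at time `i`: `x(i) + x₁(i) + v(i)`. -/
def received {q : ℕ} (c : Code a q₀ q₁ n M) (w : Fin M) (s : c.S) (u : c.U)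
    (n₀ : ℕ → Fin q₀) (n₁ : ℕ → Fin q₁) (v : ℕ → Fin q) (i : ℕ) : Fin q :=
  modAdd ((c.sent w s u n₀ n₁ i).1 + (c.sent w s u n₀ n₁ i).2) (v i)

variable {Ω : Type*} [MeasurableSpace Ω]

/-- The law of the private randomness and of the noise, which are independent. -/
def law (c : Code a q₀ q₁ n M) (μ : Measure Ω) : Measure (c.S × c.U × Ω) :=
  c.lawS.prod (c.lawU.prod μ)

/-- The average probability of error at the destination. -/
def errorProb (c : Code a q₀ q₁ n M) (μ : Measure Ω) (N₀ : ℕ → Ω → Fin q₀)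
    (N₁ : ℕ → Ω → Fin q₁) : ℝ :=
  ∑ w : Fin M, (1 / M : ℝ) * (c.law μ).real {t |
    c.dec (fun i : Fin n => c.received w t.1 t.2.1 (N₀ · t.2.2) (N₁ · t.2.2) (N₁ · t.2.2) i)
      (fun i : Fin n => (c.sent w t.1 t.2.1 (N₀ · t.2.2) (N₁ · t.2.2) i).2) ≠ w}

/-- The joint mass function of the message `W`, uniform on `M` values, and of the block `Z` of the
`n` symbols received by the wiretapper. -/
def jointWZ (c : Code a q₀ q₁ n M) (μ : Measure Ω) (N₀ : ℕ → Ω → Fin q₀)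
    (N₁ : ℕ → Ω → Fin q₁) (N₂ : ℕ → Ω → Fin q₂) (w : Fin M) (z : Fin n → Fin q₂) : ℝ :=
  (1 / M : ℝ) * (c.law μ).real {t |
    (fun i : Fin n => c.received w t.1 t.2.1 (N₀ · t.2.2) (N₁ · t.2.2) (N₂ · t.2.2) i) = z}

/-- The equivocation rate `H(W | Z) / n` at the wiretapper. -/
def equivocationRate (c : Code a q₀ q₁ n M) (μ : Measure Ω) (N₀ : ℕ → Ω → Fin q₀)
    (N₁ : ℕ → Ω → Fin q₁) (N₂ : ℕ → Ω → Fin q₂) : ℝ :=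
  condEntropy (c.jointWZ μ N₀ N₁ N₂) / n

end Code

variable {Ω : Type*} [MeasurableSpace Ω]

/-- The secrecy rate `R` is achievable over the wiretap channel with noisy feedback. The rate of the
code meets `R` up to `ε`, because `2 ^ (n * R)` need not be an integer. -/
def SecrecyAchievable (μ : Measure Ω) (a : ℕ) {q₀ q₁ q₂ : ℕ} (N₀ : ℕ → Ω → Fin q₀)
    (N₁ : ℕ → Ω → Fin q₁) (N₂ : ℕ → Ω → Fin q₂) (R : ℝ) : Prop :=
  ∀ ε : ℝ, 0 < ε → ∃ n₀ : ℕ, ∀ n : ℕ, n₀ ≤ n → ∃ (M : ℕ) (_ : 0 < M) (c : Code a q₀ q₁ n M),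
    |Real.logb 2 M / n - R| ≤ ε ∧
    c.errorProb μ N₀ N₁ ≤ ε ∧
    R - ε ≤ c.equivocationRate μ N₀ N₁ N₂

/-- The average probability of error of a codebook `x` and a decoder `d` over the main channel
`y(i) = x(i) + n₁(i)`, without wiretapper and without feedback. -/
def mainErrorProb (μ : Measure Ω) {a q₁ n M : ℕ} (N₁ : ℕ → Ω → Fin q₁)
    (x : Fin M → Fin n → Fin a) (d : (Fin n → Fin q₁) → Fin M) : ℝ :=
  ∑ w : Fin M, (1 / M : ℝ) * μ.real {ω | d (fun i : Fin n => modAdd (x w i) (N₁ i ω)) ≠ w}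

/-- The rate `R` is achievable over the main channel, without wiretapper and without feedback. -/
def MainAchievable (μ : Measure Ω) (a : ℕ) {q₁ : ℕ} (N₁ : ℕ → Ω → Fin q₁) (R : ℝ) : Prop :=
  ∀ ε : ℝ, 0 < ε → ∃ n₀ : ℕ, ∀ n : ℕ, n₀ ≤ n → ∃ (M : ℕ) (_ : 0 < M)
    (x : Fin M → Fin n → Fin a) (d : (Fin n → Fin q₁) → Fin M),
    |Real.logb 2 M / n - R| ≤ ε ∧ mainErrorProb μ N₁ x d ≤ ε

/-- The transition probabilities of the main channel. -/
def mainChannel (μ : Measure Ω) (a : ℕ) {q₁ : ℕ} (N₁ : ℕ → Ω → Fin q₁) (x : Fin a)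
    (y : Fin q₁) : ℝ :=
  μ.real {ω | modAdd x (N₁ 0 ω) = y}

/-- The capacity `max I(X; Y)`, over all input distributions, of the main channel. -/
def mainCapacity (μ : Measure Ω) (a : ℕ) {q₁ : ℕ} (N₁ : ℕ → Ω → Fin q₁) : ℝ :=
  sSup ((fun p => mutualInfo p (mainChannel μ a N₁)) '' stdSimplex ℝ (Fin a))

end

end ModWiretap

/-! Feedback acts as a one-time pad. The destination sends independent symbols uniform on the
wiretapper's alphabet, so `Z` is uniform whatever the message and the noise are. The destination
knows its own symbols and subtracts them. Any ordinary code for the main channel thus becomes a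
perfectly secret code with the same rate and error probability
(`secrecyAchievable_of_mainAchievable`), and rates below capacity are reached by Feinstein's greedy
construction with i.i.d. inputs and a Chernoff bound (`mainAchievable_of_lt_mutualInfo`).

Conversely, reliable decoding alone forces the rate below capacity. Some fixed values of the private
randomness do at least as well as the average. The feedback can then be computed from the outputs `X
+ N₁` stripped of it, so what remains is a deterministic code whose inputs depend causally on past
noise. In place of Fano's inequality, `correct_mul_logb_le` compares the output law with the product
of its averaged marginals: the mean log-likelihood ratio is a sum of `n` mutual informations, while
`log t ≤ t - 1` bounds it below by the probability of correct decoding times `log M`, minus one. -/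

namespace ModWiretap

/-! ### Feinstein's lemma and the Chernoff bound for information density -/

/-- **Feinstein's lemma**: codewords with disjoint decoding sets can be chosen greedily. -/
theorem feinstein {A B : Type*} [Fintype A] [Fintype B] (p : A → ℝ) (V : A → B → ℝ)
    (hp : ∀ x, 0 ≤ p x) (hp1 : ∑ x, p x = 1) (hV : ∀ x y, 0 ≤ V x y) (hV1 : ∀ x, ∑ y, V x y = 1)
    (γ ε : ℝ) (hγ : 0 < γ) (M : ℕ)
    (h : (∑ x, ∑ y, if V x y ≤ γ * ∑ x', p x' * V x' y then p x * V x y else 0) + M / γ < ε) :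
    ∀ m ≤ M, ∃ (x : Fin m → A) (D : Fin m → Finset B), Pairwise (Function.onFun Disjoint D) ∧
      (∀ j, ∀ y ∈ D j, γ * ∑ x', p x' * V x' y < V (x j) y) ∧
      ∀ j, 1 - ε ≤ ∑ y ∈ D j, V (x j) y := by
  classical
  intro m
  induction m with
  | zero => exact fun _ => ⟨Fin.elim0, Fin.elim0, fun i => i.elim0, fun i => i.elim0, fun i => i.elim0⟩
  | succ m ih =>
    intro hm
    obtain ⟨x, D, hD, hS, hC⟩ := ih (by omega)
    set Q : B → ℝ := fun y => ∑ x', p x' * V x' y with hQ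
    have hQ0 : ∀ y, 0 ≤ Q y := fun y => Finset.sum_nonneg fun x _ => mul_nonneg (hp x) (hV x y)
    let E : Finset B := Finset.univ.biUnion D
    let S : A → Finset B := fun x => Finset.univ.filter fun y => γ * Q y < V x y
    -- On a decoding set `V (x j)` exceeds `γ * Q` and has total mass at most one, so each set has
    -- `Q`-mass at most `1 / γ`.
    have hE : ∑ y ∈ E, Q y ≤ m / γ := by
      have h1 : ∀ j, ∑ y ∈ D j, Q y ≤ 1 / γ := by
        intro j
        rw [le_div_iff₀ hγ, mul_comm, Finset.mul_sum]
        calc ∑ y ∈ D j, γ * Q y ≤ ∑ y ∈ D j, V (x j) y :=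
              Finset.sum_le_sum fun y hy => (hS j y hy).le
          _ ≤ ∑ y, V (x j) y :=
              Finset.sum_le_sum_of_subset_of_nonneg (Finset.subset_univ _) fun y _ _ => hV _ y
          _ = 1 := hV1 _
      calc ∑ y ∈ E, Q y = ∑ j, ∑ y ∈ D j, Q y :=
            Finset.sum_biUnion fun i _ j _ hij => hD hij
        _ ≤ ∑ _j : Fin m, 1 / γ := Finset.sum_le_sum fun j _ => h1 j
        _ = m / γ := by simp [div_eq_mul_inv]
    -- Otherwise split the mass of each `V x'` into new points, used points and points below the
    -- threshold. Averaging over `p` turns the used part into the `Q`-mass of `E`, and the total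
    -- falls below one by `h`.
    have key : ∃ x', 1 - ε ≤ ∑ y ∈ S x' \ E, V x' y := by
      by_contra! hc
      have h1 : ∀ x', (1 : ℝ) ≤ ∑ y ∈ S x' \ E, V x' y + ∑ y ∈ E, V x' y
          + ∑ y, if V x' y ≤ γ * Q y then V x' y else 0 := by
        intro x'
        rw [← hV1 x', ← Finset.sum_filter_add_sum_filter_not Finset.univ (fun y => γ * Q y < V x' y),
          Finset.sum_filter (fun y => ¬ _)]
        simp only [not_lt]
        gcongr
        rw [← Finset.sum_union Finset.sdiff_disjoint]
        refine Finset.sum_le_sum_of_subset_of_nonneg ?_ fun y _ _ => hV _ y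
        intro y hy
        simp only [Finset.mem_union, Finset.mem_sdiff]
        by_cases hyE : y ∈ E
        · exact Or.inr hyE
        · exact Or.inl ⟨hy, hyE⟩
      have h2 : (1 : ℝ) ≤ (1 - ε) + ∑ y ∈ E, Q y
          + ∑ x, ∑ y, if V x y ≤ γ * Q y then p x * V x y else 0 := by
        calc (1 : ℝ) = ∑ x', p x' * 1 := by simp [hp1]
          _ ≤ ∑ x', p x' * ((1 - ε) + ∑ y ∈ E, V x' y
              + ∑ y, if V x' y ≤ γ * Q y then V x' y else 0) := by
            refine Finset.sum_le_sum fun x' _ => mul_le_mul_of_nonneg_left ?_ (hp x')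
            linarith [h1 x', hc x']
          _ = _ := by
            simp only [mul_add, Finset.sum_add_distrib, ← Finset.sum_mul, hp1, one_mul]
            congr 1
            · congr 1
              simp only [hQ, Finset.mul_sum]
              exact Finset.sum_comm
            · simp only [Finset.mul_sum, mul_ite, mul_zero]
      have h3 : (m : ℝ) / γ ≤ M / γ := by
        gcongr
        exact_mod_cast (by omega : m ≤ M)
      linarith
    obtain ⟨x', hx'⟩ := key
    refine ⟨Fin.snoc x x', Fin.snoc D (S x' \ E), ?_, ?_, ?_⟩
    · have hdis : ∀ j, Disjoint (D j) (S x' \ E) := fun j =>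
        (Finset.disjoint_sdiff).mono_left (Finset.subset_biUnion_of_mem D (Finset.mem_univ j))
      intro i j hij
      induction i using Fin.lastCases with
      | last =>
        induction j using Fin.lastCases with
        | last => exact absurd rfl hij
        | cast j => simpa [Function.onFun] using (hdis j).symm
      | cast i =>
        induction j using Fin.lastCases with
        | last => simpa [Function.onFun] using hdis i
        | cast j => simpa [Function.onFun] using hD (fun e => hij (by rw [e]))
    · intro j
      induction j using Fin.lastCases with
      | last =>
        intro y hy
        simp only [Fin.snoc_last] at hy ⊢
        exact (Finset.mem_filter.1 (Finset.mem_sdiff.1 hy).1).2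
      | cast j => simpa using hS j
    · intro j
      induction j using Fin.lastCases with
      | last => simpa using hx'
      | cast j => simpa using hC j

theorem sum_sum_prod_eq_pow {A B : Type*} [Fintype A] [Fintype B] (n : ℕ) (f : A → B → ℝ) :
    ∑ x : Fin n → A, ∑ y : Fin n → B, ∏ i, f (x i) (y i) = (∑ x, ∑ y, f x y) ^ n := by
  classical
  calc ∑ x : Fin n → A, ∑ y : Fin n → B, ∏ i, f (x i) (y i)
      = ∑ x : Fin n → A, ∏ i, ∑ y, f (x i) y := by
        refine Finset.sum_congr rfl fun x _ => ?_
        rw [Finset.prod_univ_sum, Fintype.piFinset_univ]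
    _ = ∏ _i : Fin n, ∑ x, ∑ y, f x y := by
        rw [Finset.prod_univ_sum, Fintype.piFinset_univ]
    _ = _ := by simp

theorem sum_prod_mul_prod {A B : Type*} [Fintype A] (n : ℕ) (p : A → ℝ) (V : A → B → ℝ)
    (y : Fin n → B) :
    ∑ x : Fin n → A, (∏ i, p (x i)) * ∏ i, V (x i) (y i) = ∏ i, ∑ x, p x * V x (y i) := by
  classical
  rw [Finset.prod_univ_sum, Fintype.piFinset_univ]
  simp only [Finset.prod_mul_distrib]

/-- The Chernoff bound for the event that the information density of a block is small. -/
theorem sum_threshold_le {A B : Type*} [Fintype A] [Fintype B] (p : A → ℝ) (V : A → B → ℝ)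
    (hp : ∀ x, 0 ≤ p x) (hV : ∀ x y, 0 ≤ V x y) (n : ℕ) (r s : ℝ) (hs : 0 < s) :
    (∑ x : Fin n → A, ∑ y : Fin n → B,
      if ∏ i, V (x i) (y i) ≤ Real.exp r ^ n *
          ∑ x' : Fin n → A, (∏ i, p (x' i)) * ∏ i, V (x' i) (y i)
        then (∏ i, p (x i)) * ∏ i, V (x i) (y i) else 0) ≤
      (∑ x, ∑ y, p x * V x y * (Real.exp r * (∑ x', p x' * V x' y) / V x y) ^ s) ^ n := by
  rw [← sum_sum_prod_eq_pow]
  have hQ : ∀ y, 0 ≤ ∑ x', p x' * V x' y :=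
    fun y => Finset.sum_nonneg fun x _ => mul_nonneg (hp x) (hV x y)
  have hb : ∀ x y, 0 ≤ Real.exp r * (∑ x', p x' * V x' y) / V x y :=
    fun x y => div_nonneg (mul_nonneg (Real.exp_pos r).le (hQ y)) (hV x y)
  refine Finset.sum_le_sum fun x _ => Finset.sum_le_sum fun y _ => ?_
  rw [sum_prod_mul_prod, Finset.prod_mul_distrib, Finset.prod_mul_distrib,
    Real.finsetProd_rpow _ _ fun i _ => hb _ _]
  have h0 : 0 ≤ (∏ i, p (x i)) * ∏ i, V (x i) (y i) :=
    mul_nonneg (Finset.prod_nonneg fun i _ => hp _) (Finset.prod_nonneg fun i _ => hV _ _)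
  have hc : 0 ≤ ∏ i, Real.exp r * (∑ x', p x' * V x' (y i)) / V (x i) (y i) :=
    Finset.prod_nonneg fun i _ => hb _ _
  split_ifs with hle
  · rcases (Finset.prod_nonneg fun i _ => hV (x i) (y i) :
      0 ≤ ∏ i, V (x i) (y i)).eq_or_lt with h | h
    · simp [← h]
    · refine le_mul_of_one_le_right h0 (Real.one_le_rpow ?_ hs.le)
      rw [Finset.prod_div_distrib, Finset.prod_mul_distrib, one_le_div h]
      simpa using hle
  · exact mul_nonneg h0 (Real.rpow_nonneg hc s)

/-- At `s = 0` the sum equals one, and its derivative there is `r - I(X; Y) * log 2`, which is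
negative. A small positive `s` therefore works. -/
theorem exists_chernoff_lt_one {A B : Type*} [Fintype A] [Fintype B] (p : A → ℝ) (V : A → B → ℝ)
    (hp : ∀ x, 0 ≤ p x) (hp1 : ∑ x, p x = 1) (hV : ∀ x y, 0 ≤ V x y) (hV1 : ∀ x, ∑ y, V x y = 1)
    (r : ℝ) (hr : r < mutualInfo p V * Real.log 2) :
    ∃ s : ℝ, 0 < s ∧
      ∑ x, ∑ y, p x * V x y * (Real.exp r * (∑ x', p x' * V x' y) / V x y) ^ s < 1 := by
  have hpV : ∑ x, ∑ y, p x * V x y = 1 := by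
    simp [← Finset.mul_sum, hV1, hp1]
  have hQ : ∀ x y, p x * V x y ≤ ∑ x', p x' * V x' y := fun x y =>
    Finset.single_le_sum (f := fun x' => p x' * V x' y)
      (fun x _ => mul_nonneg (hp x) (hV x y)) (Finset.mem_univ x)
  have hder : HasDerivAt
      (fun s : ℝ => ∑ x, ∑ y, p x * V x y * (Real.exp r * (∑ x', p x' * V x' y) / V x y) ^ s)
      (r - mutualInfo p V * Real.log 2) 0 := by
    have : r - mutualInfo p V * Real.log 2 = ∑ x, ∑ y, p x * V x y *
        (r - Real.log (V x y / ∑ x', p x' * V x' y)) := by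
      simp only [mul_sub, Finset.sum_sub_distrib, ← Finset.sum_mul, hpV, one_mul, mutualInfo,
        Real.logb]
      congr 1
      simp only [Finset.sum_mul]
      refine Finset.sum_congr rfl fun x _ => Finset.sum_congr rfl fun y _ => ?_
      have : Real.log 2 ≠ 0 := (Real.log_pos one_lt_two).ne'
      field_simp
    rw [this]
    refine HasDerivAt.fun_sum fun x _ => HasDerivAt.fun_sum fun y _ => ?_
    rcases (mul_nonneg (hp x) (hV x y)).eq_or_lt with h | h
    · simpa [← h] using hasDerivAt_const (0 : ℝ) (0 : ℝ)
    · have hVp : 0 < V x y := pos_of_mul_pos_right h (hp x)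
      have hQp : 0 < ∑ x', p x' * V x' y := h.trans_le (hQ x y)
      have hb : 0 < Real.exp r * (∑ x', p x' * V x' y) / V x y := by positivity
      have h1 := ((Real.hasStrictDerivAt_const_rpow hb 0).hasDerivAt).const_mul (p x * V x y)
      refine h1.congr_deriv ?_
      rw [Real.rpow_zero, one_mul, mul_div_assoc, Real.log_mul (Real.exp_pos r).ne' (by positivity),
        Real.log_exp, ← inv_div, Real.log_inv, sub_eq_add_neg]
  have h0 := (hasDerivAt_iff_tendsto_slope.1 hder).mono_left
    (nhdsWithin_mono (0 : ℝ) (s := Set.Ioi 0) fun x (hx : (0 : ℝ) < x) => hx.ne')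
  obtain ⟨s, hs1, hs2⟩ := ((h0.eventually_lt_const (sub_neg.2 hr)).and
    (self_mem_nhdsWithin : Set.Ioi (0 : ℝ) ∈ _)).exists
  refine ⟨s, hs2, ?_⟩
  rw [slope_def_field, sub_zero, div_lt_iff₀ hs2, zero_mul, sub_neg] at hs1
  simpa [hpV] using hs1

end ModWiretap

/-! ### Direct part for the main channel -/

namespace ModWiretap

variable {Ω : Type*} [MeasurableSpace Ω] {μ : Measure Ω} {a q₁ : ℕ}
  {N₁ : ℕ → Ω → Fin q₁}

theorem mainChannel_nonneg (x : Fin a) (y : Fin q₁) : 0 ≤ mainChannel μ a N₁ x y :=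
  measureReal_nonneg

theorem measurable_modAdd_comp {q : ℕ} {N : Ω → Fin q} (hN : Measurable N) (m : ℕ) :
    Measurable fun ω => modAdd m (N ω) :=
  (measurable_of_finite (fun v : Fin q => modAdd m v)).comp hN

theorem sum_mainChannel [IsProbabilityMeasure μ] (hN₁ : ∀ i, Measurable (N₁ i)) (x : Fin a) :
    ∑ y, mainChannel μ a N₁ x y = 1 := by
  have := sum_measureReal_preimage_singleton (μ := μ) (f := fun ω => modAdd x (N₁ 0 ω))
    Finset.univ fun y _ => measurable_modAdd_comp (hN₁ 0) x (measurableSet_singleton y)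
  simpa [mainChannel, Set.preimage] using this

theorem measureReal_block_eq (indep₁ : iIndepFun N₁ μ)
    (ident₁ : ∀ i, IdentDistrib (N₁ i) (N₁ 0) μ μ) {n : ℕ} (x : Fin n → Fin a)
    (y : Fin n → Fin q₁) :
    μ.real {ω | (fun i : Fin n => modAdd (x i) (N₁ i ω)) = y} =
      ∏ i, mainChannel μ a N₁ (x i) (y i) := by
  have h := (indep₁.precomp (g := fun i : Fin n => (i : ℕ)) Fin.val_injective)
    |>.measure_inter_preimage_eq_mul Finset.univ
      (sets := fun i => {v | modAdd (x i) v = y i}) fun i _ => Set.Finite.measurableSet (Set.toFinite _)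
  have h2 : {ω | (fun i : Fin n => modAdd (x i) (N₁ i ω)) = y} =
      ⋂ i ∈ (Finset.univ : Finset (Fin n)), N₁ i ⁻¹' {v | modAdd (x i) v = y i} := by
    ext ω
    simp [funext_iff]
  rw [h2, Measure.real, h, ENNReal.toReal_prod]
  refine Finset.prod_congr rfl fun i _ => ?_
  rw [(ident₁ i).measure_mem_eq (Set.Finite.measurableSet (Set.toFinite _))]
  rfl

/-- The direct part of the channel coding theorem for the main channel. -/
theorem mainAchievable_of_lt_mutualInfo [IsProbabilityMeasure μ]
    (hN₁ : ∀ i, Measurable (N₁ i))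
    (indep₁ : iIndepFun N₁ μ) (ident₁ : ∀ i, IdentDistrib (N₁ i) (N₁ 0) μ μ) (p : Fin a → ℝ)
    (hp : p ∈ stdSimplex ℝ (Fin a)) (R : ℝ) (hR0 : 0 ≤ R)
    (hR : R < mutualInfo p (mainChannel μ a N₁)) : MainAchievable μ a N₁ R := by
  set V := mainChannel μ a N₁ with hVdef
  have hV0 : ∀ x y, 0 ≤ V x y := mainChannel_nonneg
  have hV1 : ∀ x, ∑ y, V x y = 1 := sum_mainChannel hN₁
  have hlog2 : 0 < Real.log 2 := Real.log_pos one_lt_two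
  -- The threshold `exp r ^ n` lies strictly between `2 ^ (n * R)` and the typical likelihood ratio,
  -- so both error terms of Feinstein's lemma decay geometrically.
  obtain ⟨r, hr1, hr2⟩ := exists_between (mul_lt_mul_of_pos_right hR hlog2)
  obtain ⟨s, hs, hφ⟩ := exists_chernoff_lt_one p V hp.1 hp.2 hV0 hV1 r hr2
  set φ := ∑ x, ∑ y, p x * V x y * (Real.exp r * (∑ x', p x' * V x' y) / V x y) ^ s
  have hφ0 : 0 ≤ φ := Finset.sum_nonneg fun x _ => Finset.sum_nonneg fun y _ =>
    mul_nonneg (mul_nonneg (hp.1 x) (hV0 x y)) (Real.rpow_nonneg (div_nonneg (mul_nonneg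
      (Real.exp_pos r).le (Finset.sum_nonneg fun x' _ => mul_nonneg (hp.1 x') (hV0 x' y)))
      (hV0 x y)) s)
  intro ε hε
  have hlim : Filter.Tendsto (fun n : ℕ => φ ^ n + 2 * Real.exp (R * Real.log 2 - r) ^ n)
      Filter.atTop (nhds 0) := by
    have h1 := tendsto_pow_atTop_nhds_zero_of_lt_one hφ0 hφ
    have h2 := tendsto_pow_atTop_nhds_zero_of_lt_one
      (Real.exp_pos (R * Real.log 2 - r)).le (Real.exp_lt_one_iff.2 (sub_neg.2 hr1))
    simpa using h1.add (h2.const_mul 2)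
  have hlim2 : Filter.Tendsto (fun n : ℕ => (1 : ℝ) / n) Filter.atTop (nhds 0) :=
    tendsto_one_div_atTop_nhds_zero_nat
  obtain ⟨n₀, hn₀⟩ := Filter.eventually_atTop.1 ((hlim.eventually_lt_const hε).and
    ((hlim2.eventually_lt_const hε).and (Filter.eventually_ge_atTop 1)))
  refine ⟨n₀, fun n hn => ?_⟩
  obtain ⟨h1, h2, h3⟩ := hn₀ n hn
  have hn0 : (0 : ℝ) < n := by exact_mod_cast h3
  -- The code has `⌈t⌉₊` words. As `R ≥ 0` gives `t ≥ 1`, rounding up at most doubles `t` and costs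
  -- at most `1 / n` in rate.
  set t : ℝ := 2 ^ (n * R) with ht
  have ht1 : 1 ≤ t := Real.one_le_rpow one_le_two (by positivity)
  have htM : t ≤ (⌈t⌉₊ : ℝ) := Nat.le_ceil t
  have htM2 : (⌈t⌉₊ : ℝ) ≤ 2 * t := by
    have := (Nat.ceil_lt_add_one (by linarith : 0 ≤ t)).le
    linarith
  have hM : 0 < ⌈t⌉₊ := Nat.ceil_pos.2 (by linarith)
  obtain ⟨x, D, hD, -, hC⟩ := feinstein (fun x : Fin n → Fin a => ∏ i, p (x i))
    (fun x (y : Fin n → Fin q₁) => ∏ i, V (x i) (y i))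
    (fun x => Finset.prod_nonneg fun i _ => hp.1 _)
    (by
      have := Finset.prod_univ_sum (fun _ : Fin n => Finset.univ) (fun _ x => p x)
      rw [Fintype.piFinset_univ] at this
      simp [← this, hp.2])
    (fun x y => Finset.prod_nonneg fun i _ => hV0 _ _)
    (fun x => by
      have := Finset.prod_univ_sum (fun _ : Fin n => Finset.univ) (fun i y => V (x i) y)
      rw [Fintype.piFinset_univ] at this
      simp [← this, hV1])
    (Real.exp r ^ n) ε (by positivity) ⌈t⌉₊
    (by
      refine lt_of_le_of_lt (add_le_add (sum_threshold_le p V hp.1 hV0 n r s hs) ?_) h1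
      rw [div_le_iff₀ (by positivity), mul_assoc, ← mul_pow, ← Real.exp_add, sub_add_cancel]
      refine htM2.trans_eq ?_
      rw [ht, Real.rpow_def_of_pos two_pos, ← Real.exp_nat_mul]
      ring_nf)
    ⌈t⌉₊ le_rfl
  classical
  have : Nonempty (Fin ⌈t⌉₊) := ⟨⟨0, hM⟩⟩
  let d : (Fin n → Fin q₁) → Fin ⌈t⌉₊ := fun y =>
    if h : ∃ j, y ∈ D j then h.choose else ⟨0, hM⟩
  have hd : ∀ j, ∀ y ∈ D j, d y = j := by
    intro j y hy
    have hex : ∃ j, y ∈ D j := ⟨j, hy⟩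
    simp only [d, dif_pos hex]
    by_contra hne
    exact Finset.disjoint_left.1 (hD hne) hex.choose_spec hy
  refine ⟨⌈t⌉₊, hM, x, d, ?_, ?_⟩
  · have hl1 : n * R ≤ Real.logb 2 ⌈t⌉₊ := by
      rw [Real.le_logb_iff_rpow_le one_lt_two (by positivity)]
      exact htM
    have hl2 : Real.logb 2 ⌈t⌉₊ ≤ n * R + 1 := by
      rw [Real.logb_le_iff_le_rpow one_lt_two (by positivity), Real.rpow_add two_pos, Real.rpow_one]
      linarith
    have : Real.logb 2 ⌈t⌉₊ / n - R = (Real.logb 2 ⌈t⌉₊ - n * R) / n := by field_simp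
    rw [this, abs_of_nonneg (div_nonneg (by linarith) hn0.le)]
    refine le_trans ?_ h2.le
    gcongr
    linarith
  · unfold mainErrorProb
    have hw : ∀ w, μ.real {ω | d (fun i : Fin n => modAdd (x w i) (N₁ i ω)) ≠ w} ≤ ε := by
      intro w
      have hmeas : Measurable fun ω => fun i : Fin n => modAdd (x w i) (N₁ i ω) :=
        measurable_pi_lambda _ fun i => measurable_modAdd_comp (hN₁ i) _
      have hsub : {ω | d (fun i : Fin n => modAdd (x w i) (N₁ i ω)) ≠ w} ⊆
          ((fun ω => fun i : Fin n => modAdd (x w i) (N₁ i ω)) ⁻¹' (D w : Set _))ᶜ := by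
        intro ω hω hmem
        exact hω (hd w _ hmem)
      refine (measureReal_mono hsub).trans ?_
      rw [probReal_compl_eq_one_sub (hmeas (Set.Finite.measurableSet (Set.toFinite _))),
        ← sum_measureReal_preimage_singleton (D w)
          fun y _ => hmeas (measurableSet_singleton y)]
      have := hC w
      have hsum : ∑ y ∈ D w, μ.real ((fun ω => fun i : Fin n => modAdd (x w i) (N₁ i ω)) ⁻¹' {y})
          = ∑ y ∈ D w, ∏ i, V (x w i) (y i) :=
        Finset.sum_congr rfl fun y _ => measureReal_block_eq indep₁ ident₁ (x w) y
      linarith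
    calc _ ≤ ∑ _w : Fin ⌈t⌉₊, (1 / ⌈t⌉₊ : ℝ) * ε :=
          Finset.sum_le_sum fun w _ => mul_le_mul_of_nonneg_left (hw w) (by positivity)
      _ = ε := by
          have : (⌈t⌉₊ : ℝ) ≠ 0 := by positivity
          simp
          field_simp

/-- A single codeword suffices. This case is needed when the capacity is zero, since then no
nonnegative rate lies strictly below it. -/
theorem mainAchievable_zero (ha : 0 < a) : MainAchievable μ a N₁ 0 := by
  intro ε hε
  refine ⟨0, fun n _ => ⟨1, one_pos, fun _ _ => ⟨0, ha⟩, fun _ => 0, ?_, ?_⟩⟩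
  · simpa using hε.le
  · simpa [mainErrorProb, Fin.eq_zero] using hε.le

end ModWiretap

/-! ### Masking by random feedback -/

namespace ModWiretap

/-- Removal of a known shift: the inverse of the map `m ↦ modAdd m v` with respect to `x₁`. -/
def modSub {q : ℕ} (y : Fin q) (m : ℕ) : Fin q :=
  ⟨(y + (q - m % q)) % q, Nat.mod_lt _ y.pos⟩

/-- This is how the destination removes its mask. The mask `m'` is drawn from the wiretapper's
alphabet and may exceed `q`, hence the reduction inside `modSub`. -/
theorem modSub_modAdd_add {q : ℕ} (m m' : ℕ) (v : Fin q) :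
    modSub (modAdd (m + m') v) m' = modAdd m v := by
  have hq := v.pos
  have hlt := Nat.mod_lt m' hq
  ext
  change ((m + m' + v) % q + (q - m' % q)) % q = (m + v) % q
  rw [Nat.mod_add_mod]
  have h : m + m' + v + (q - m' % q) = m + v + q * (m' / q + 1) := by
    have := Nat.mod_add_div m' q
    rw [mul_add]
    omega
  rw [h, Nat.add_mul_mod_self_left]

theorem modAdd_injective {q : ℕ} (m : ℕ) : Function.Injective (modAdd m : Fin q → Fin q) := by
  intro v v' h
  have h1 : (m + v) % q = (m + v') % q := congrArg Fin.val h
  have h2 : (v : ℕ) % q = v' % q := Nat.ModEq.add_left_cancel' m h1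
  rw [Nat.mod_eq_of_lt v.2, Nat.mod_eq_of_lt v'.2] at h2
  exact Fin.ext h2

theorem modAdd_bijective {q : ℕ} (m : ℕ) : Function.Bijective (modAdd m : Fin q → Fin q) :=
  Finite.injective_iff_bijective.1 (modAdd_injective m)

theorem modAdd_add_comm {q : ℕ} (m : ℕ) (u v : Fin q) : modAdd (m + u) v = modAdd (m + v) u := by
  ext
  simp [modAdd, add_right_comm]

section Masking

variable {Ω : Type*} [MeasurableSpace Ω] {μ : Measure Ω} {a q₀ q₁ q₂ n M : ℕ}

/-- The code in which the source ignores the feedback, and the destination masks the codeword with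
independent uniform symbols of the wiretapper's alphabet. -/
noncomputable def maskedCode (q₀ : ℕ) (hq₂ : 0 < q₂) (x : Fin M → Fin n → Fin a) (ha : 0 < a)
    (d : (Fin n → Fin q₁) → Fin M) : Code a q₀ q₁ n M where
  S := Unit
  lawS := Measure.dirac ()
  U := Fin n → Fin q₂
  lawU := uniformOn Set.univ
  probU := by
    have : Nonempty (Fin q₂) := ⟨⟨0, hq₂⟩⟩
    infer_instance
  k := q₂
  enc i w _ _ := if h : i < n then x w ⟨i, h⟩ else ⟨0, ha⟩
  enc_meas _ _ _ := measurable_const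
  fb i u _ := if h : i < n then u ⟨i, h⟩ else ⟨0, hq₂⟩
  fb_meas _ _ := measurable_of_finite _
  dec y x₁ := d fun i => modSub (y i) (x₁ i)

variable (hq₂ : 0 < q₂) (x : Fin M → Fin n → Fin a) (ha : 0 < a) (d : (Fin n → Fin q₁) → Fin M)

theorem sent_maskedCode (w : Fin M) (s : (maskedCode q₀ hq₂ x ha d).S)
    (u : (maskedCode q₀ hq₂ x ha d).U) (n₀ : ℕ → Fin q₀) (n₁ : ℕ → Fin q₁) (i : Fin n) :
    (maskedCode q₀ hq₂ x ha d).sent w s u n₀ n₁ i = (x w i, u i) := by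
  rw [Code.sent]
  simp [maskedCode]

theorem errorProb_maskedCode [IsProbabilityMeasure μ] (N₀ : ℕ → Ω → Fin q₀) (N₁ : ℕ → Ω → Fin q₁)
    (hN₁ : ∀ i, Measurable (N₁ i)) :
    (maskedCode q₀ hq₂ x ha d).errorProb μ N₀ N₁ = mainErrorProb μ N₁ x d := by
  unfold Code.errorProb mainErrorProb
  refine Finset.sum_congr rfl fun w _ => ?_
  congr 1
  simp only [Code.received, sent_maskedCode]
  have hset : {t : (maskedCode q₀ hq₂ x ha d).S × (maskedCode q₀ hq₂ x ha d).U × Ω |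
      (maskedCode q₀ hq₂ x ha d).dec (fun i : Fin n => modAdd (x w i + t.2.1 i) (N₁ i t.2.2))
        (fun i : Fin n => t.2.1 i) ≠ w} =
      (Prod.snd ∘ Prod.snd) ⁻¹' {ω | d (fun i : Fin n => modAdd (x w i) (N₁ i ω)) ≠ w} := by
    ext t
    simp only [maskedCode, modSub_modAdd_add]
    rfl
  refine (congrArg _ hset).trans ?_
  have hmp : MeasurePreserving (Prod.snd ∘ Prod.snd) ((maskedCode q₀ hq₂ x ha d).law μ) μ :=
    measurePreserving_snd.comp measurePreserving_snd
  refine hmp.measureReal_preimage (MeasurableSet.nullMeasurableSet ?_)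
  have hmeas : Measurable fun ω => fun i : Fin n => modAdd (x w i) (N₁ i ω) :=
    measurable_pi_lambda _ fun i => measurable_modAdd_comp (hN₁ i) _
  exact hmeas (Set.Finite.measurableSet (Set.toFinite {y | d y ≠ w}))

/-- For each noise realization exactly one mask produces `z`, because mask and noise can be
exchanged in the sum and `modAdd` is injective. Only the independence of mask and noise matters, not
the law of the noise. -/
theorem measure_masked_eq [IsProbabilityMeasure μ] {S : Type*} [MeasurableSpace S] (ν : Measure S)
    [IsProbabilityMeasure ν] (f : Fin n → ℕ) (N : ℕ → Ω → Fin q₂) (hN : ∀ i, Measurable (N i))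
    (z : Fin n → Fin q₂) :
    (ν.prod ((uniformOn Set.univ : Measure (Fin n → Fin q₂)).prod μ)) {t |
      (fun i : Fin n => modAdd (f i + t.2.1 i) (N i t.2.2)) = z} =
      1 / Fintype.card (Fin n → Fin q₂) := by
  have h1 : ∀ ω, (uniformOn Set.univ : Measure (Fin n → Fin q₂))
      {u | (fun i : Fin n => modAdd (f i + u i) (N i ω)) = z} =
      1 / Fintype.card (Fin n → Fin q₂) := by
    intro ω
    have hex : ∀ i, ∃ v : Fin q₂, modAdd (f i + N i ω) v = z i := fun i =>
      (modAdd_bijective _).2 (z i)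
    choose v hv using hex
    have hs : {u : Fin n → Fin q₂ | (fun i : Fin n => modAdd (f i + u i) (N i ω)) = z} = {v} := by
      ext u
      simp only [Set.mem_ofPred_eq, Set.mem_singleton_iff, funext_iff]
      refine forall_congr' fun i => ?_
      rw [modAdd_add_comm, ← hv i]
      exact (modAdd_injective _).eq_iff
    rw [hs, uniformOn_univ]
    simp
  have : Nonempty (Fin n → Fin q₂) := ⟨z⟩
  have hS : MeasurableSet {t : (Fin n → Fin q₂) × Ω |
      (fun i : Fin n => modAdd (f i + t.1 i) (N i t.2)) = z} := by
    have hm : Measurable fun t : (Fin n → Fin q₂) × Ω => (t.1, fun i : Fin n => N i t.2) := by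
      fun_prop
    exact hm (Set.Finite.measurableSet (Set.toFinite
      {t : (Fin n → Fin q₂) × (Fin n → Fin q₂) | (fun i => modAdd (f i + t.1 i) (t.2 i)) = z}))
  refine (measurePreserving_snd.measure_preimage hS.nullMeasurableSet).trans ?_
  rw [Measure.prod_apply_symm hS]
  refine (lintegral_congr h1).trans ?_
  simp

theorem jointWZ_maskedCode [IsProbabilityMeasure μ] (N₀ : ℕ → Ω → Fin q₀) (N₁ : ℕ → Ω → Fin q₁)
    (N₂ : ℕ → Ω → Fin q₂) (hN₂ : ∀ i, Measurable (N₂ i)) (w : Fin M) (z : Fin n → Fin q₂) :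
    (maskedCode q₀ hq₂ x ha d).jointWZ μ N₀ N₁ N₂ w z =
      (1 / M : ℝ) * (1 / Fintype.card (Fin n → Fin q₂)) := by
  unfold Code.jointWZ
  congr 1
  simp only [Code.received, sent_maskedCode]
  refine (congrArg ENNReal.toReal (measure_masked_eq (maskedCode q₀ hq₂ x ha d).lawS
    (fun i => x w i) N₂ hN₂ z)).trans ?_
  simp

/-- The joint mass function is constant, so `W` stays uniform given `Z`: secrecy is perfect. -/
theorem equivocationRate_maskedCode [IsProbabilityMeasure μ] (hM : 0 < M) (N₀ : ℕ → Ω → Fin q₀)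
    (N₁ : ℕ → Ω → Fin q₁) (N₂ : ℕ → Ω → Fin q₂) (hN₂ : ∀ i, Measurable (N₂ i)) :
    (maskedCode q₀ hq₂ x ha d).equivocationRate μ N₀ N₁ N₂ = Real.logb 2 M / n := by
  unfold Code.equivocationRate
  congr 1
  have : Nonempty (Fin q₂) := ⟨⟨0, hq₂⟩⟩
  have hc : (Fintype.card (Fin n → Fin q₂) : ℝ) ≠ 0 := by
    exact_mod_cast Fintype.card_ne_zero
  have hM' : (M : ℝ) ≠ 0 := by positivity
  simp only [condEntropy, jointWZ_maskedCode hq₂ x ha d N₀ N₁ N₂ hN₂, Finset.sum_const,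
    Finset.card_univ, nsmul_eq_mul, Fintype.card_fin]
  generalize (Fintype.card (Fin n → Fin q₂) : ℝ) = K at hc
  have : (M : ℝ) * (1 / M * (1 / K)) / (1 / M * (1 / K)) = M := by field_simp
  rw [this]
  field_simp

theorem secrecyAchievable_of_mainAchievable [IsProbabilityMeasure μ] (ha : 0 < a)
    (N₀ : ℕ → Ω → Fin q₀) (N₁ : ℕ → Ω → Fin q₁) (N₂ : ℕ → Ω → Fin q₂)
    (hN₁ : ∀ i, Measurable (N₁ i)) (hN₂ : ∀ i, Measurable (N₂ i)) {R : ℝ}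
    (h : MainAchievable μ a N₁ R) : SecrecyAchievable μ a N₀ N₁ N₂ R := by
  obtain ⟨ω⟩ := μ.nonempty_of_neZero
  have hq₂ : 0 < q₂ := (N₂ 0 ω).pos
  intro ε hε
  obtain ⟨n₀, hn₀⟩ := h ε hε
  refine ⟨n₀, fun n hn => ?_⟩
  obtain ⟨M, hM, x, d, h1, h2⟩ := hn₀ n hn
  refine ⟨M, hM, maskedCode q₀ hq₂ x ha d, h1, ?_, ?_⟩
  · rwa [errorProb_maskedCode hq₂ x ha d N₀ N₁ hN₁]
  · rw [equivocationRate_maskedCode hq₂ x ha d hM N₀ N₁ N₂ hN₂]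
    linarith [(abs_le.1 h1).1]

end Masking

end ModWiretap

/-! ### Expectations of finite-valued random variables -/

namespace ModWiretap

section FiniteValued

variable {Ω α β : Type*} [MeasurableSpace Ω] {μ : Measure Ω} [IsProbabilityMeasure μ]
  [MeasurableSpace α] [Finite α] [MeasurableSingletonClass α]
  [MeasurableSpace β] [Fintype β] [MeasurableSingletonClass β]

theorem integrable_comp_of_finite {h : Ω → α} (hh : Measurable h) (g : α → ℝ) :
    Integrable (fun ω => g (h ω)) μ := by
  have : IsProbabilityMeasure (μ.map h) := Measure.isProbabilityMeasure_map hh.aemeasurable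
  exact (Integrable.of_finite (μ := μ.map h) (f := g)).comp_measurable hh

theorem integral_comp_eq_sum {v : Ω → β} (hv : Measurable v) (g : β → ℝ) :
    ∫ ω, g (v ω) ∂μ = ∑ b, μ.real {ω | v ω = b} * g b := by
  have : IsProbabilityMeasure (μ.map v) := Measure.isProbabilityMeasure_map hv.aemeasurable
  rw [← integral_map (f := g) hv.aemeasurable (measurable_of_finite g).aestronglyMeasurable,
    integral_fintype Integrable.of_finite]
  refine Finset.sum_congr rfl fun b _ => ?_
  rw [map_measureReal_apply hv (measurableSet_singleton b)]
  rfl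

/-- Splitting along the value of `v` leaves products of an indicator and a function of `h`, which
independence factors. Memorylessness enters the converse in this form. -/
theorem integral_comp_eq_sum_of_indepFun {h : Ω → α} {v : Ω → β} (hh : Measurable h)
    (hv : Measurable v) (hi : IndepFun v h μ) (g : α → β → ℝ) :
    ∫ ω, g (h ω) (v ω) ∂μ = ∑ b, μ.real {ω | v ω = b} * ∫ ω, g (h ω) b ∂μ := by
  classical
  have h1 : ∀ ω, g (h ω) (v ω) = ∑ b, (if v ω = b then 1 else 0) * g (h ω) b := by
    intro ω
    simp
  simp only [h1]
  rw [integral_finsetSum _ fun b _ => integrable_comp_of_finite (hv.prodMk hh)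
    fun t : β × α => (if t.1 = b then 1 else 0) * g t.2 b]
  refine Finset.sum_congr rfl fun b _ => ?_
  have hi' : IndepFun (fun ω => if v ω = b then (1 : ℝ) else 0) (fun ω => g (h ω) b) μ :=
    hi.comp (φ := fun b' => if b' = b then (1 : ℝ) else 0) (ψ := fun x => g x b)
      (measurable_of_finite _) (measurable_of_finite _)
  rw [hi'.integral_fun_mul_eq_mul_integral
    (integrable_comp_of_finite hv fun b' => if b' = b then (1 : ℝ) else 0).aestronglyMeasurable
    (integrable_comp_of_finite hh fun x => g x b).aestronglyMeasurable]
  congr 1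
  rw [integral_comp_eq_sum hv fun b' => if b' = b then (1 : ℝ) else 0]
  simp

/-- The null values are finite in number, so together they have probability zero. This allows
logarithms of likelihood ratios to be taken. -/
theorem ae_measureReal_fiber_pos {v : Ω → β} (hv : Measurable v) :
    ∀ᵐ ω ∂μ, 0 < μ.real {ω' | v ω' = v ω} := by
  refine ae_of_ae_map (p := fun b => 0 < μ.real {ω' | v ω' = b}) hv.aemeasurable ?_
  rw [ae_iff_of_countable]
  intro b hb
  rw [Measure.map_apply hv (measurableSet_singleton b)] at hb
  exact ENNReal.toReal_pos hb (measure_ne_top _ _)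

end FiniteValued

theorem sum_fin_snoc {B : Type*} [Fintype B] {n : ℕ} (F : (Fin (n + 1) → B) → ℝ) :
    ∑ y, F y = ∑ y' : Fin n → B, ∑ b, F (Fin.snoc y' b) := by
  rw [← (Fin.snocEquiv fun _ : Fin (n + 1) => B).sum_comp, Fintype.sum_prod_type_right]
  rfl

theorem sum_modAdd {q : ℕ} (m : ℕ) (F : Fin q → ℝ) : ∑ v, F (modAdd m v) = ∑ y, F y :=
  (Equiv.ofBijective _ (modAdd_bijective m)).sum_comp F

/-! ### Converse for inputs that depend on past noise -/

section Converse

variable {Ω : Type*} [MeasurableSpace Ω] {μ : Measure Ω} {a q₀ q₁ : ℕ}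
  {N₀ : ℕ → Ω → Fin q₀} {N₁ : ℕ → Ω → Fin q₁}

/-- The noise samples, on both signals, before the time `i`. -/
def past (N₀ : ℕ → Ω → Fin q₀) (N₁ : ℕ → Ω → Fin q₁) (i : ℕ) (ω : Ω) : Fin i → Fin q₀ × Fin q₁ :=
  fun j => (N₀ j ω, N₁ j ω)

/-- The output at time `i` of the main channel, when the input depends on the past noise. -/
def output (N₀ : ℕ → Ω → Fin q₀) (N₁ : ℕ → Ω → Fin q₁)
    (X : (i : ℕ) → (Fin i → Fin q₀ × Fin q₁) → Fin a) (i : ℕ) (ω : Ω) : Fin q₁ :=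
  modAdd (X i (past N₀ N₁ i ω)) (N₁ i ω)

/-- The output at time `i` as a function of the noise before a later time. -/
def outputOfPast (X : (i : ℕ) → (Fin i → Fin q₀ × Fin q₁) → Fin a) {n : ℕ}
    (h : Fin n → Fin q₀ × Fin q₁) (i : Fin n) : Fin q₁ :=
  modAdd (X i fun j => h (Fin.castLE i.2.le j)) (h i).2

omit [MeasurableSpace Ω] in
theorem output_eq_outputOfPast (X : (i : ℕ) → (Fin i → Fin q₀ × Fin q₁) → Fin a) {n : ℕ} (ω : Ω)
    (i : Fin n) : output N₀ N₁ X i ω = outputOfPast X (past N₀ N₁ n ω) i := rfl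

theorem measurable_past (hN₀ : ∀ i, Measurable (N₀ i)) (hN₁ : ∀ i, Measurable (N₁ i)) (i : ℕ) :
    Measurable (past N₀ N₁ i) :=
  measurable_pi_lambda _ fun j => (hN₀ j).prodMk (hN₁ j)

/-- The mass function of the noise. -/
noncomputable def noiseMass (μ : Measure Ω) (N₁ : ℕ → Ω → Fin q₁) (v : Fin q₁) : ℝ :=
  μ.real {ω | N₁ 0 ω = v}

theorem mainChannel_modAdd (x : Fin a) (v : Fin q₁) :
    mainChannel μ a N₁ x (modAdd x v) = noiseMass μ N₁ v := by
  simp only [mainChannel, noiseMass, (modAdd_injective _).eq_iff]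

theorem measureReal_noise_eq (ident₁ : ∀ i, IdentDistrib (N₁ i) (N₁ 0) μ μ) (i : ℕ) (v : Fin q₁) :
    μ.real {ω | N₁ i ω = v} = noiseMass μ N₁ v :=
  congrArg ENNReal.toReal ((ident₁ i).measure_mem_eq (measurableSet_singleton v))

variable [IsProbabilityMeasure μ]

/-- The change of measure from the law of the outputs, under feedback, to a product law. -/
theorem integral_likelihoodRatio_le (hN₀ : ∀ i, Measurable (N₀ i)) (hN₁ : ∀ i, Measurable (N₁ i))
    (ident₁ : ∀ i, IdentDistrib (N₁ i) (N₁ 0) μ μ)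
    (memoryless : ∀ i : ℕ, IndepFun (N₁ i) (past N₀ N₁ i) μ)
    (X : (i : ℕ) → (Fin i → Fin q₀ × Fin q₁) → Fin a) (Q : ℕ → Fin q₁ → ℝ)
    (hQ : ∀ i y, 0 ≤ Q i y) (n : ℕ) (f : (Fin n → Fin q₁) → ℝ) (hf : ∀ y, 0 ≤ f y) :
    ∫ ω, (∏ i : Fin n, Q i (output N₀ N₁ X i ω) / noiseMass μ N₁ (N₁ i ω)) *
      f (fun i : Fin n => output N₀ N₁ X i ω) ∂μ ≤ ∑ y, (∏ i : Fin n, Q i (y i)) * f y := by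
  induction n with
  | zero => simp [Subsingleton.elim (default : Fin 0 → Fin q₁) (fun i => i.elim0),
      Subsingleton.elim (fun i : Fin 0 => output N₀ N₁ X i _) (fun i => i.elim0)]
  | succ n ih =>
    have hν : ∀ v, 0 ≤ noiseMass μ N₁ v := fun v => measureReal_nonneg
    let G : (Fin n → Fin q₀ × Fin q₁) → ℝ := fun h =>
      ∏ i : Fin n, Q i (outputOfPast X h i) / noiseMass μ N₁ (h i).2
    have hG : ∀ h, 0 ≤ G h := fun h => Finset.prod_nonneg fun i _ => div_nonneg (hQ _ _) (hν _)
    let g : (Fin n → Fin q₀ × Fin q₁) → Fin q₁ → ℝ := fun h v =>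
      (G h * (Q n (modAdd (X n h) v) / noiseMass μ N₁ v)) *
        f (Fin.snoc (outputOfPast X h) (modAdd (X n h) v))
    have h1 : ∀ ω, (∏ i : Fin (n + 1), Q i (output N₀ N₁ X i ω) / noiseMass μ N₁ (N₁ i ω)) *
        f (fun i : Fin (n + 1) => output N₀ N₁ X i ω) = g (past N₀ N₁ n ω) (N₁ n ω) := by
      intro ω
      have : (fun i : Fin (n + 1) => output N₀ N₁ X i ω) =
          Fin.snoc (outputOfPast X (past N₀ N₁ n ω)) (modAdd (X n (past N₀ N₁ n ω)) (N₁ n ω)) := by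
        ext i
        induction i using Fin.lastCases with
        | last => simp [output]
        | cast i => simp [← output_eq_outputOfPast]
      rw [this, Fin.prod_univ_castSucc]
      rfl
    have hp := measurable_past hN₀ hN₁ n
    simp only [h1]
    -- The last noise sample is averaged out given the past; its mass cancels the denominator of the
    -- last factor.
    rw [integral_comp_eq_sum_of_indepFun hp (hN₁ n) (memoryless n) g]
    simp only [measureReal_noise_eq ident₁, ← integral_const_mul]
    rw [← integral_finsetSum _ fun v _ => integrable_comp_of_finite hp
      fun h => noiseMass μ N₁ v * g h v]
    calc ∫ ω, ∑ v, noiseMass μ N₁ v * g (past N₀ N₁ n ω) v ∂μ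
        ≤ ∫ ω, G (past N₀ N₁ n ω) * ∑ b, Q n b *
            f (Fin.snoc (outputOfPast X (past N₀ N₁ n ω)) b) ∂μ := by
          refine integral_mono
            (integrable_comp_of_finite hp fun h => ∑ v, noiseMass μ N₁ v * g h v)
            (integrable_comp_of_finite hp fun h => G h * ∑ b, Q n b *
              f (Fin.snoc (outputOfPast X h) b)) fun ω => ?_
          set h := past N₀ N₁ n ω
          dsimp only
          rw [← sum_modAdd (X n h) fun b => Q n b * f (Fin.snoc (outputOfPast X h) b),
            Finset.mul_sum]
          refine Finset.sum_le_sum fun v _ => ?_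
          simp only [g]
          rw [← mul_assoc (G h), ← mul_assoc]
          refine mul_le_mul_of_nonneg_right ?_ (hf _)
          rw [mul_left_comm]
          refine mul_le_mul_of_nonneg_left ?_ (hG h)
          -- A noise value of mass zero contributes zero on the left but possibly something on the
          -- right, so only an inequality holds.
          rcases (hν v).eq_or_lt with h0 | h0
          · simpa [← h0] using hQ _ _
          · rw [mul_div_cancel₀ _ h0.ne']
      -- The induction hypothesis is applied to `f` with its last argument averaged under `Q n`.
      _ ≤ ∑ y' : Fin n → Fin q₁, (∏ i : Fin n, Q i (y' i)) * ∑ b, Q n b * f (Fin.snoc y' b) :=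
          ih (fun y' => ∑ b, Q n b * f (Fin.snoc y' b)) fun y' =>
            Finset.sum_nonneg fun b _ => mul_nonneg (hQ _ _) (hf _)
      _ = _ := by
          rw [sum_fin_snoc]
          refine Finset.sum_congr rfl fun y' _ => ?_
          rw [Finset.mul_sum]
          refine Finset.sum_congr rfl fun b _ => ?_
          rw [Fin.prod_univ_castSucc]
          simp [mul_assoc]

/-- The input at time `i` is a function of the past, hence independent of `N₁ i`; given that it
equals `x`, the output has law `V x`. Averaged over messages, with `Q` the resulting output law,
this is a mutual information in nats. -/
theorem integral_log_likelihood (hN₀ : ∀ i, Measurable (N₀ i)) (hN₁ : ∀ i, Measurable (N₁ i))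
    (ident₁ : ∀ i, IdentDistrib (N₁ i) (N₁ 0) μ μ)
    (memoryless : ∀ i : ℕ, IndepFun (N₁ i) (past N₀ N₁ i) μ)
    (X : (i : ℕ) → (Fin i → Fin q₀ × Fin q₁) → Fin a) (Q : Fin q₁ → ℝ) (i : ℕ) :
    ∫ ω, Real.log (noiseMass μ N₁ (N₁ i ω) / Q (output N₀ N₁ X i ω)) ∂μ =
      ∑ x, μ.real {ω | X i (past N₀ N₁ i ω) = x} *
        ∑ y, mainChannel μ a N₁ x y * Real.log (mainChannel μ a N₁ x y / Q y) := by
  have hX : Measurable fun ω => X i (past N₀ N₁ i ω) :=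
    (measurable_of_finite (X i)).comp (measurable_past hN₀ hN₁ i)
  have hi : IndepFun (N₁ i) (fun ω => X i (past N₀ N₁ i ω)) μ :=
    (memoryless i).comp measurable_id (measurable_of_finite (X i))
  have := integral_comp_eq_sum_of_indepFun hX (hN₁ i) hi
    fun x v => Real.log (noiseMass μ N₁ v / Q (modAdd x v))
  refine this.trans ?_
  simp only [measureReal_noise_eq ident₁, Finset.mul_sum]
  have h2 : ∀ v, ∫ ω, Real.log (noiseMass μ N₁ v / Q (modAdd (X i (past N₀ N₁ i ω)) v)) ∂μ =
      ∑ x, μ.real {ω | X i (past N₀ N₁ i ω) = x} * Real.log (noiseMass μ N₁ v / Q (modAdd x v)) :=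
    fun v => integral_comp_eq_sum hX fun x => Real.log (noiseMass μ N₁ v / Q (modAdd x v))
  simp only [h2, Finset.mul_sum]
  rw [Finset.sum_comm]
  refine Finset.sum_congr rfl fun x _ => ?_
  rw [← sum_modAdd x fun y => μ.real {ω | X i (past N₀ N₁ i ω) = x} *
    (mainChannel μ a N₁ x y * Real.log (mainChannel μ a N₁ x y / Q y))]
  refine Finset.sum_congr rfl fun v _ => ?_
  rw [mainChannel_modAdd]
  ring

/-- The supremum defining the capacity has meaning only with such a bound. Each term is at most `1 /
log 2`, from `log t ≤ t - 1` and `p x * V x y ≤ Q y`. -/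
theorem bddAbove_mutualInfo (hN₁ : ∀ i, Measurable (N₁ i)) :
    BddAbove ((fun p => mutualInfo p (mainChannel μ a N₁)) '' stdSimplex ℝ (Fin a)) := by
  have hlog2 : 0 < Real.log 2 := Real.log_pos one_lt_two
  refine ⟨∑ _x : Fin a, ∑ _y : Fin q₁, 1 / Real.log 2, ?_⟩
  rintro _ ⟨p, hp, rfl⟩
  refine Finset.sum_le_sum fun x _ => Finset.sum_le_sum fun y _ => ?_
  set V := mainChannel μ a N₁
  have hV0 : ∀ x y, 0 ≤ V x y := mainChannel_nonneg
  have hV1 : V x y ≤ 1 := by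
    rw [← sum_mainChannel (μ := μ) hN₁ x]
    exact Finset.single_le_sum (fun y _ => hV0 x y) (Finset.mem_univ y)
  have hQ : p x * V x y ≤ ∑ x', p x' * V x' y :=
    Finset.single_le_sum (f := fun x' => p x' * V x' y)
      (fun x _ => mul_nonneg (hp.1 x) (hV0 x y)) (Finset.mem_univ x)
  rcases (mul_nonneg (hp.1 x) (hV0 x y)).eq_or_lt with h | h
  · rw [← h, zero_mul]
    positivity
  · rw [Real.logb, ← mul_div_assoc]
    gcongr
    have hQ0 := h.trans_le hQ
    have hVp : 0 < V x y := pos_of_mul_pos_right h (hp.1 x)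
    calc p x * V x y * Real.log (V x y / ∑ x', p x' * V x' y)
        ≤ p x * V x y * (V x y / ∑ x', p x' * V x' y) := by
          refine mul_le_mul_of_nonneg_left ?_ h.le
          linarith [Real.log_le_sub_one_of_pos (div_pos hVp hQ0)]
      _ = V x y * (p x * V x y / ∑ x', p x' * V x' y) := by ring
      _ ≤ 1 * 1 := by
          gcongr
          exact (div_le_one hQ0).2 hQ
      _ = 1 := one_mul 1

/-- The converse of the coding theorem for the main channel: feedback, including feedback that
depends on past noise on other signals, does not increase the capacity. -/
theorem correct_mul_logb_le (hN₀ : ∀ i, Measurable (N₀ i)) (hN₁ : ∀ i, Measurable (N₁ i))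
    (ident₁ : ∀ i, IdentDistrib (N₁ i) (N₁ 0) μ μ)
    (memoryless : ∀ i : ℕ, IndepFun (N₁ i) (past N₀ N₁ i) μ) {n M : ℕ} (hM : 0 < M)
    (X : Fin M → (i : ℕ) → (Fin i → Fin q₀ × Fin q₁) → Fin a)
    (D : (Fin n → Fin q₁) → Fin M) :
    (∑ w, (1 / M : ℝ) * μ.real {ω | D (fun i : Fin n => output N₀ N₁ (X w) i ω) = w}) *
      Real.logb 2 M ≤ n * mainCapacity μ a N₁ + 1 / Real.log 2 := by
  classical
  have hlog2 : 0 < Real.log 2 := Real.log_pos one_lt_two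
  have hM0 : (0 : ℝ) < M := by exact_mod_cast hM
  have hM1 : (1 : ℝ) ≤ M := by exact_mod_cast hM
  set V := mainChannel μ a N₁ with hV
  have hV0 : ∀ x y, 0 ≤ V x y := mainChannel_nonneg
  let P : Fin M → ℕ → Fin a → ℝ := fun w i x => μ.real {ω | X w i (past N₀ N₁ i ω) = x}
  let p : ℕ → Fin a → ℝ := fun i x => ∑ w, (1 / M : ℝ) * P w i x
  have hP0 : ∀ w i x, 0 ≤ P w i x := fun _ _ _ => measureReal_nonneg
  have hXm : ∀ w i, Measurable fun ω => X w i (past N₀ N₁ i ω) := fun w i =>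
    (measurable_of_finite (X w i)).comp (measurable_past hN₀ hN₁ i)
  have hP1 : ∀ w i, ∑ x, P w i x = 1 := by
    intro w i
    have := sum_measureReal_preimage_singleton (μ := μ) (f := fun ω => X w i (past N₀ N₁ i ω))
      Finset.univ fun y _ => hXm w i (measurableSet_singleton y)
    simpa [P, Set.preimage] using this
  have hp : ∀ i, p i ∈ stdSimplex ℝ (Fin a) := by
    refine fun i => ⟨fun x => Finset.sum_nonneg fun w _ => mul_nonneg (by positivity) (hP0 w i x), ?_⟩
    simp only [p]
    rw [Finset.sum_comm]
    simp only [← Finset.mul_sum, hP1]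
    simp [hM0.ne']
  -- `Q i` is the output law at time `i` averaged over messages. The reference law of the block is
  -- the product of the `Q i`, although the outputs themselves need not be independent.
  let Q : ℕ → Fin q₁ → ℝ := fun i y => ∑ x, p i x * V x y
  have hQ0 : ∀ i y, 0 ≤ Q i y := fun i y => Finset.sum_nonneg fun x _ =>
    mul_nonneg ((hp i).1 x) (hV0 x y)
  have hQ1 : ∀ i, ∑ y, Q i y = 1 := by
    intro i
    simp only [Q]
    rw [Finset.sum_comm]
    simp only [← Finset.mul_sum, hV, sum_mainChannel hN₁, mul_one]
    exact (hp i).2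
  have hQprod : ∑ y : Fin n → Fin q₁, ∏ i : Fin n, Q i (y i) = 1 := by
    have := Finset.prod_univ_sum (fun _ : Fin n => Finset.univ) (fun i y => Q i y)
    rw [Fintype.piFinset_univ] at this
    simp [← this, hQ1]
  let T : Fin M → Ω → ℝ := fun w ω =>
    ∑ i : Fin n, Real.log (noiseMass μ N₁ (N₁ i ω) / Q i (output N₀ N₁ (X w) i ω))
  have hpast := measurable_past hN₀ hN₁ n
  have hTint : ∀ w (i : Fin n), Integrable (fun ω =>
      Real.log (noiseMass μ N₁ (N₁ i ω) / Q i (output N₀ N₁ (X w) i ω))) μ := fun w i =>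
    integrable_comp_of_finite hpast fun h =>
      Real.log (noiseMass μ N₁ (h i).2 / Q i (outputOfPast (X w) h i))
  have hmean : ∑ w, (1 / M : ℝ) * ∫ ω, T w ω ∂μ ≤ n * mainCapacity μ a N₁ * Real.log 2 := by
    have h1 : ∀ w, ∫ ω, T w ω ∂μ = ∑ i : Fin n, ∑ x, P w i x *
        ∑ y, V x y * Real.log (V x y / Q i y) := by
      intro w
      rw [integral_finsetSum _ fun i _ => hTint w i]
      exact Finset.sum_congr rfl fun i _ =>
        integral_log_likelihood hN₀ hN₁ ident₁ memoryless (X w) (Q i) i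
    calc ∑ w, (1 / M : ℝ) * ∫ ω, T w ω ∂μ
        = ∑ i : Fin n, mutualInfo (p i) V * Real.log 2 := by
          simp only [h1, Finset.mul_sum Finset.univ (fun i : Fin n => _)]
          rw [Finset.sum_comm]
          refine Finset.sum_congr rfl fun i _ => ?_
          simp only [Finset.mul_sum Finset.univ (fun x : Fin a => _)]
          rw [Finset.sum_comm]
          simp only [mutualInfo, Finset.sum_mul]
          refine Finset.sum_congr rfl fun x _ => ?_
          simp only [← mul_assoc]
          rw [← Finset.sum_mul]
          change p i x * _ = _
          rw [Finset.mul_sum]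
          refine Finset.sum_congr rfl fun y _ => ?_
          simp only [Real.logb, Q]
          field_simp
      _ ≤ ∑ _i : Fin n, mainCapacity μ a N₁ * Real.log 2 := by
          refine Finset.sum_le_sum fun i _ => ?_
          gcongr
          exact le_csSup (bddAbove_mutualInfo hN₁) ⟨p i, hp i, rfl⟩
      _ = _ := by simp [mul_assoc]
  let A : Fin M → Set Ω := fun w => {ω | D (fun i : Fin n => output N₀ N₁ (X w) i ω) = w}
  let r : Fin M → Ω → ℝ := fun w ω =>
    ∏ i : Fin n, Q i (output N₀ N₁ (X w) i ω) / noiseMass μ N₁ (N₁ i ω)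
  let e : Fin M → (Fin n → Fin q₁) → ℝ := fun w y => if D y = w then 1 else 0
  have he : ∀ w y, 0 ≤ e w y := fun w y => by simp only [e]; split_ifs <;> norm_num
  have hr1 : ∀ w, ∫ ω, r w ω ∂μ ≤ 1 := by
    intro w
    have := integral_likelihoodRatio_le hN₀ hN₁ ident₁ memoryless (X w) Q hQ0 n (fun _ => 1)
      fun _ => zero_le_one
    simpa only [mul_one, hQprod] using this
  have hr2 : ∀ w, ∫ ω, r w ω * e w (fun i : Fin n => output N₀ N₁ (X w) i ω) ∂μ ≤
      ∑ y : Fin n → Fin q₁, (∏ i : Fin n, Q i (y i)) * e w y := fun w =>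
    integral_likelihoodRatio_le hN₀ hN₁ ident₁ memoryless (X w) Q hQ0 n (e w) (he w)
  have hr1int : ∀ w, Integrable (r w) μ := fun w => integrable_comp_of_finite hpast fun h =>
    ∏ i : Fin n, Q i (outputOfPast (X w) h i) / noiseMass μ N₁ (h i).2
  have hr2int : ∀ w, Integrable (fun ω => r w ω * e w (fun i : Fin n => output N₀ N₁ (X w) i ω)) μ :=
    fun w => integrable_comp_of_finite hpast fun h =>
      (∏ i : Fin n, Q i (outputOfPast (X w) h i) / noiseMass μ N₁ (h i).2) *
        e w (outputOfPast (X w) h)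
  have heint : ∀ w, Integrable (fun ω => e w (fun i : Fin n => output N₀ N₁ (X w) i ω)) μ :=
    fun w => integrable_comp_of_finite hpast fun h => e w (outputOfPast (X w) h)
  have hAe : ∀ w, ∫ ω, e w (fun i : Fin n => output N₀ N₁ (X w) i ω) ∂μ = μ.real (A w) := by
    intro w
    have hmeas : MeasurableSet (A w) := by
      change MeasurableSet ((past N₀ N₁ n) ⁻¹' {h | D (outputOfPast (X w) h) = w})
      exact hpast (Set.Finite.measurableSet (Set.toFinite _))
    rw [← integral_indicator_one hmeas]
    refine integral_congr_ae (.of_forall fun ω => ?_)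
    simp [e, A, Set.indicator]
  have hmain : ∀ w, Real.log M * μ.real (A w) -
      M * ∑ y : Fin n → Fin q₁, (∏ i : Fin n, Q i (y i)) * e w y ≤ ∫ ω, T w ω ∂μ := by
    intro w
    have hpos : ∀ᵐ ω ∂μ, ∀ i : Fin n, 0 < noiseMass μ N₁ (N₁ i ω) ∧
        0 < Q i (output N₀ N₁ (X w) i ω) := by
      rw [ae_all_iff]
      intro i
      filter_upwards [ae_measureReal_fiber_pos (μ := μ) (hN₁ i),
        ae_measureReal_fiber_pos (μ := μ) (hXm w i)] with ω h1 h2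
      rw [measureReal_noise_eq ident₁] at h1
      refine ⟨h1, ?_⟩
      have h3 : 0 < p i (X w i (past N₀ N₁ i ω)) := by
        refine Finset.sum_pos' (fun w' _ => mul_nonneg (by positivity) (hP0 w' i _))
          ⟨w, Finset.mem_univ w, mul_pos (by positivity) h2⟩
      refine Finset.sum_pos' (fun x _ => mul_nonneg ((hp i).1 x) (hV0 x _))
        ⟨X w i (past N₀ N₁ i ω), Finset.mem_univ _, mul_pos h3 ?_⟩
      rw [output, hV, mainChannel_modAdd]
      exact h1
    -- Since `T = -log r`, the inequality `log t ≤ t - 1` is used at `t = M * r` when decoding is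
    -- correct and at `t = r` otherwise.
    have hle : ∀ᵐ ω ∂μ, Real.log M * e w (fun i : Fin n => output N₀ N₁ (X w) i ω) + 1 -
        M * (r w ω * e w (fun i : Fin n => output N₀ N₁ (X w) i ω)) - r w ω ≤ T w ω := by
      filter_upwards [hpos] with ω hω
      have hr0 : 0 < r w ω := Finset.prod_pos fun i _ => div_pos (hω i).2 (hω i).1
      have hTr : T w ω = -Real.log (r w ω) := by
        simp only [T, r]
        rw [Real.log_prod fun i _ => (div_pos (hω i).2 (hω i).1).ne', ← Finset.sum_neg_distrib]
        refine Finset.sum_congr rfl fun i _ => ?_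
        rw [← Real.log_inv, inv_div]
      rw [hTr]
      simp only [e]
      split_ifs
      · have := Real.log_le_sub_one_of_pos (mul_pos hM0 hr0)
        rw [Real.log_mul hM0.ne' hr0.ne'] at this
        linarith
      · have := Real.log_le_sub_one_of_pos hr0
        linarith
    have i1 : Integrable (fun ω =>
        Real.log M * e w (fun i : Fin n => output N₀ N₁ (X w) i ω) + 1) μ :=
      ((heint w).const_mul _).add (integrable_const 1)
    have i2 := (hr2int w).const_mul (M : ℝ)
    have i3 : Integrable (fun ω =>
        Real.log M * e w (fun i : Fin n => output N₀ N₁ (X w) i ω) + 1 -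
        M * (r w ω * e w (fun i : Fin n => output N₀ N₁ (X w) i ω))) μ := i1.sub i2
    have h1 := integral_mono_ae (i3.sub (hr1int w))
      (integrable_finsetSum _ fun i _ => hTint w i) hle
    have h2 : ∫ ω, (Real.log M * e w (fun i : Fin n => output N₀ N₁ (X w) i ω) + 1 -
        M * (r w ω * e w (fun i : Fin n => output N₀ N₁ (X w) i ω)) - r w ω) ∂μ =
        Real.log M * μ.real (A w) + 1 -
        M * (∫ ω, r w ω * e w (fun i : Fin n => output N₀ N₁ (X w) i ω) ∂μ) - ∫ ω, r w ω ∂μ := by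
      rw [integral_sub i3 (hr1int w), integral_sub i1 i2,
        integral_add ((heint w).const_mul (Real.log M)) (integrable_const 1),
        integral_const_mul, integral_const_mul, hAe]
      simp
    have h3 := h2.symm.trans_le h1
    have h4 := mul_le_mul_of_nonneg_left (hr2 w) hM0.le
    have h5 := hr1 w
    change _ ≤ ∫ ω, T w ω ∂μ at h3
    linarith
  have hsum : Real.log M * (∑ w, (1 / M : ℝ) * μ.real (A w)) - 1 ≤
      n * mainCapacity μ a N₁ * Real.log 2 := by
    refine le_trans (le_of_eq ?_) ((Finset.sum_le_sum fun w _ =>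
      mul_le_mul_of_nonneg_left (hmain w) (by positivity : (0 : ℝ) ≤ 1 / M)).trans hmean)
    -- The decision regions partition the output blocks, so their masses under the product law add
    -- up to one.
    have h1 : ∑ w, ∑ y : Fin n → Fin q₁, (∏ i : Fin n, Q i (y i)) * e w y = 1 := by
      rw [Finset.sum_comm]
      simp [e, hQprod]
    have h2 : ∀ w, (1 / M : ℝ) * (Real.log M * μ.real (A w) -
        M * ∑ y : Fin n → Fin q₁, (∏ i : Fin n, Q i (y i)) * e w y) =
        Real.log M * ((1 / M : ℝ) * μ.real (A w)) -
          ∑ y : Fin n → Fin q₁, (∏ i : Fin n, Q i (y i)) * e w y := by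
      intro w
      field_simp
    simp only [h2, Finset.sum_sub_distrib, h1, ← Finset.mul_sum]
  rw [Real.logb, ← mul_div_assoc, div_le_iff₀ hlog2, add_mul, one_div_mul_cancel hlog2.ne']
  change (∑ w, (1 / M : ℝ) * μ.real (A w)) * _ ≤ _
  linarith

end Converse

end ModWiretap

/-! ### Reduction of feedback codes to deterministic inputs -/

namespace ModWiretap

theorem exists_integral_section_le {α β : Type*} [MeasurableSpace α] [MeasurableSpace β]
    (ν : Measure α) [IsProbabilityMeasure ν] (ρ : Measure β) [IsProbabilityMeasure ρ]
    {f : α × β → ℝ} (hf : Integrable f (ν.prod ρ)) :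
    ∃ x, ∫ y, f (x, y) ∂ρ ≤ ∫ t, f t ∂(ν.prod ρ) := by
  rw [integral_prod _ hf]
  exact exists_le_integral hf.integral_prod_left

theorem modAdd_add {q : ℕ} (m m' : ℕ) (v : Fin q) : modAdd (m + m') v = modAdd m' (modAdd m v) := by
  ext
  simp only [modAdd, Nat.add_mod_mod]
  congr 1
  omega

namespace Code

variable {a q₀ q₁ n M : ℕ} (c : Code a q₀ q₁ n M)

theorem sent_congr (w : Fin M) (s : c.S) (u : c.U) {n₀ n₀' : ℕ → Fin q₀} {n₁ n₁' : ℕ → Fin q₁}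
    (i : ℕ) (h₀ : ∀ j < i, n₀ j = n₀' j) (h₁ : ∀ j < i, n₁ j = n₁' j) :
    c.sent w s u n₀ n₁ i = c.sent w s u n₀' n₁' i := by
  induction i using Nat.strong_induction_on with
  | _ i ih =>
    have h : ∀ j : Fin i, c.sent w s u n₀ n₁ j = c.sent w s u n₀' n₁' j := fun j =>
      ih j j.2 (fun k hk => h₀ k (hk.trans j.2)) fun k hk => h₁ k (hk.trans j.2)
    rw [Code.sent, Code.sent]
    simp only [h, h₀ _ (Fin.is_lt _), h₁ _ (Fin.is_lt _)]

/-- By induction, past feedback and the outputs before it was added determine the received past,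
hence the next feedback symbol. The message and the source's randomness may differ: they act only
through those outputs. -/
theorem sent_snd_congr {w w' : Fin M} {s s' : c.S} (u : c.U) {n₀ n₀' : ℕ → Fin q₀}
    {n₁ n₁' : ℕ → Fin q₁} (i : ℕ)
    (h : ∀ j < i, modAdd (c.sent w s u n₀ n₁ j).1 (n₁ j) =
      modAdd (c.sent w' s' u n₀' n₁' j).1 (n₁' j)) :
    (c.sent w s u n₀ n₁ i).2 = (c.sent w' s' u n₀' n₁' i).2 := by
  induction i using Nat.strong_induction_on with
  | _ i ih =>
    have h' : ∀ j : Fin i, (c.sent w s u n₀ n₁ j).2 = (c.sent w' s' u n₀' n₁' j).2 := fun j =>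
      ih j j.2 fun k hk => h k (hk.trans j.2)
    rw [Code.sent, Code.sent]
    simp only [modAdd_add, h', h _ (Fin.is_lt _)]

variable {Ω : Type*} [MeasurableSpace Ω] {μ : Measure Ω} {N₀ : ℕ → Ω → Fin q₀}
  {N₁ : ℕ → Ω → Fin q₁}

theorem measurable_sent (hN₀ : ∀ i, Measurable (N₀ i)) (hN₁ : ∀ i, Measurable (N₁ i)) (w : Fin M)
    (i : ℕ) : Measurable fun t : c.S × c.U × Ω =>
      c.sent w t.1 t.2.1 (N₀ · t.2.2) (N₁ · t.2.2) i := by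
  induction i using Nat.strong_induction_on with
  | _ i ih =>
    have hr : ∀ {q : ℕ} (N : ℕ → Ω → Fin q), (∀ i, Measurable (N i)) →
        Measurable fun (t : c.S × c.U × Ω) (j : Fin i) =>
          modAdd ((c.sent w t.1 t.2.1 (N₀ · t.2.2) (N₁ · t.2.2) j).1 +
            (c.sent w t.1 t.2.1 (N₀ · t.2.2) (N₁ · t.2.2) j).2) (N j t.2.2) := by
      intro q N hN
      refine measurable_pi_lambda _ fun j => ?_
      exact (measurable_of_finite fun p : (Fin a × Fin c.k) × Fin q =>
        modAdd ((p.1.1 : ℕ) + (p.1.2 : ℕ)) p.2).comp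
        ((ih j j.2).prodMk ((hN j).comp (measurable_snd.comp measurable_snd)))
    have he : Measurable fun p : c.S × (Fin i → Fin q₀) => c.enc i w p.1 p.2 :=
      measurable_from_prod_countable_left fun y => c.enc_meas i w y
    have hf : Measurable fun p : c.U × (Fin i → Fin q₁) => c.fb i p.1 p.2 :=
      measurable_from_prod_countable_left fun y => c.fb_meas i y
    have := (he.comp (measurable_fst.prodMk (hr N₀ hN₀))).prodMk
      (hf.comp ((measurable_fst.comp measurable_snd).prodMk (hr N₁ hN₁)))
    convert this using 2 with t
    rw [Code.sent]
    rfl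

variable [IsProbabilityMeasure μ]

/-- The converse of the coding theorem for codes with noisy feedback. -/
theorem one_sub_errorProb_mul_logb_le (hN₀ : ∀ i, Measurable (N₀ i))
    (hN₁ : ∀ i, Measurable (N₁ i)) (ident₁ : ∀ i, IdentDistrib (N₁ i) (N₁ 0) μ μ)
    (memoryless : ∀ i : ℕ, IndepFun (N₁ i) (past N₀ N₁ i) μ) (hM : 0 < M) :
    (1 - c.errorProb μ N₀ N₁) * Real.logb 2 M ≤ n * mainCapacity μ a N₁ + 1 / Real.log 2 := by
  classical
  obtain ⟨ω₀⟩ := μ.nonempty_of_neZero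
  have hM0 : (0 : ℝ) < M := by exact_mod_cast hM
  have hM1 : (1 : ℝ) ≤ M := by exact_mod_cast hM
  let G : Fin M → c.S × c.U × Ω → Fin M := fun w t =>
    c.dec (fun i : Fin n => c.received w t.1 t.2.1 (N₀ · t.2.2) (N₁ · t.2.2) (N₁ · t.2.2) i)
      (fun i : Fin n => (c.sent w t.1 t.2.1 (N₀ · t.2.2) (N₁ · t.2.2) i).2)
  have hG : ∀ w, Measurable (G w) := by
    intro w
    have h1 : Measurable fun (t : c.S × c.U × Ω) (i : Fin n) =>
        (c.sent w t.1 t.2.1 (N₀ · t.2.2) (N₁ · t.2.2) i, N₁ i t.2.2) :=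
      measurable_pi_lambda _ fun i => (c.measurable_sent hN₀ hN₁ w i).prodMk
        ((hN₁ i).comp (measurable_snd.comp measurable_snd))
    exact (measurable_of_finite fun p : Fin n → (Fin a × Fin c.k) × Fin q₁ =>
      c.dec (fun i => modAdd (((p i).1.1 : ℕ) + ((p i).1.2 : ℕ)) (p i).2)
        fun i => (p i).1.2).comp h1
  have hGv : Measurable fun t w => G w t := measurable_pi_lambda _ hG
  -- The average error is written as one function of the decisions for all messages, so that a
  -- single `s` and a single `u` can be fixed for all of them at once.
  let F : (Fin M → Fin M) → ℝ := fun g => ∑ w, (1 / M : ℝ) * if g w ≠ w then 1 else 0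
  have hlaw : IsProbabilityMeasure (c.law μ) := by unfold Code.law; infer_instance
  have hreal : ∀ {Θ : Type _} [MeasurableSpace Θ] (ν : Measure Θ) [IsProbabilityMeasure ν]
      (g : Θ → Fin M → Fin M), Measurable g →
      ∫ t, F (g t) ∂ν = ∑ w, (1 / M : ℝ) * ν.real {t | g t w ≠ w} := by
    intro Θ _ ν _ g hg
    simp only [F]
    rw [integral_finsetSum _ fun w _ =>
      integrable_comp_of_finite hg fun g => (1 / M : ℝ) * if g w ≠ w then 1 else 0]
    refine Finset.sum_congr rfl fun w _ => ?_
    rw [integral_const_mul]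
    congr 1
    have hset : MeasurableSet {t | g t w ≠ w} :=
      hg (Set.Finite.measurableSet (Set.toFinite {g : Fin M → Fin M | g w ≠ w}))
    rw [← integral_indicator_one hset]
    refine integral_congr_ae (.of_forall fun t => ?_)
    simp [Set.indicator]
  have herr : c.errorProb μ N₀ N₁ = ∫ t, F (fun w => G w t) ∂(c.law μ) :=
    (hreal (c.law μ) (fun t w => G w t) hGv).symm
  obtain ⟨s, hs⟩ := exists_integral_section_le c.lawS (c.lawU.prod μ)
    (f := fun t => F fun w => G w t) (integrable_comp_of_finite (μ := c.law μ) hGv F)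
  have hGs : Measurable fun (t : c.U × Ω) w => G w (s, t) := hGv.comp measurable_prodMk_left
  obtain ⟨u, hu⟩ := exists_integral_section_le c.lawU μ
    (f := fun t => F fun w => G w (s, t)) (integrable_comp_of_finite hGs F)
  have hGu : Measurable fun (ω : Ω) w => G w (s, u, ω) := hGs.comp measurable_prodMk_left
  have herr' : ∑ w, (1 / M : ℝ) * μ.real {ω | G w (s, u, ω) ≠ w} ≤ c.errorProb μ N₀ N₁ := by
    rw [herr, ← hreal μ _ hGu]
    exact hu.trans hs
  -- The samples from time `i` on are arbitrary fillers; causality makes them irrelevant.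
  let X : Fin M → (i : ℕ) → (Fin i → Fin q₀ × Fin q₁) → Fin a := fun w i h =>
    (c.sent w s u (fun j => if hj : j < i then (h ⟨j, hj⟩).1 else N₀ 0 ω₀)
      (fun j => if hj : j < i then (h ⟨j, hj⟩).2 else N₁ 0 ω₀) i).1
  have hX : ∀ w i ω, X w i (past N₀ N₁ i ω) = (c.sent w s u (N₀ · ω) (N₁ · ω) i).1 := by
    intro w i ω
    refine congrArg Prod.fst (c.sent_congr w s u i (fun j hj => ?_) fun j hj => ?_)
    · simp [hj, past]
    · simp [hj, past]
  let Y : Fin M × Ω → Fin n → Fin q₁ := fun t i => output N₀ N₁ (X t.1) i t.2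
  -- The decision depends only on the outputs without feedback: with `u` fixed they determine the
  -- feedback, and together these give the received block.
  have hfac : Function.FactorsThrough (fun t : Fin M × Ω => G t.1 (s, u, t.2)) Y := by
    rintro ⟨w, ω⟩ ⟨w', ω'⟩ hY
    have h1 : ∀ j < n, modAdd (c.sent w s u (N₀ · ω) (N₁ · ω) j).1 (N₁ j ω) =
        modAdd (c.sent w' s u (N₀ · ω') (N₁ · ω') j).1 (N₁ j ω') := by
      intro j hj
      have := congrFun hY ⟨j, hj⟩
      simpa only [Y, output, hX] using this
    have h2 : ∀ j : Fin n, (c.sent w s u (N₀ · ω) (N₁ · ω) j).2 =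
        (c.sent w' s u (N₀ · ω') (N₁ · ω') j).2 := fun j =>
      c.sent_snd_congr u j fun k hk => h1 k (hk.trans j.2)
    simp only [G, Code.received, modAdd_add, h2, h1 _ (Fin.is_lt _)]
  let D : (Fin n → Fin q₁) → Fin M :=
    Function.extend Y (fun t : Fin M × Ω => G t.1 (s, u, t.2)) fun _ => ⟨0, hM⟩
  have hD : ∀ w ω, D (fun i : Fin n => output N₀ N₁ (X w) i ω) = G w (s, u, ω) := fun w ω =>
    hfac.extend_apply _ (w, ω)
  have hconv := correct_mul_logb_le hN₀ hN₁ ident₁ memoryless hM X D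
  simp only [hD] at hconv
  refine le_trans (mul_le_mul_of_nonneg_right ?_ (Real.logb_nonneg one_lt_two hM1)) hconv
  have hcompl : ∀ w, μ.real {ω | G w (s, u, ω) = w} = 1 - μ.real {ω | G w (s, u, ω) ≠ w} := by
    intro w
    have hset : MeasurableSet {ω | G w (s, u, ω) ≠ w} :=
      hGu (Set.Finite.measurableSet (Set.toFinite {g : Fin M → Fin M | g w ≠ w}))
    rw [← probReal_compl_eq_one_sub hset]
    congr 1
    ext ω
    simp
  simp only [hcompl, mul_sub, Finset.sum_sub_distrib]
  have : ∑ _w : Fin M, (1 / M : ℝ) * 1 = 1 := by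
    simp [hM0.ne']
  linarith

end Code

/-! ### Capacity as a least upper bound -/

variable {Ω : Type*} [MeasurableSpace Ω] {μ : Measure Ω} [IsProbabilityMeasure μ] {a q₀ q₁ q₂ : ℕ}
  {N₀ : ℕ → Ω → Fin q₀} {N₁ : ℕ → Ω → Fin q₁} {N₂ : ℕ → Ω → Fin q₂}

theorem SecrecyAchievable.le_mainCapacity (hN₀ : ∀ i, Measurable (N₀ i))
    (hN₁ : ∀ i, Measurable (N₁ i)) (ident₁ : ∀ i, IdentDistrib (N₁ i) (N₁ 0) μ μ)
    (memoryless : ∀ i : ℕ, IndepFun (N₁ i) (past N₀ N₁ i) μ) {R : ℝ}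
    (hR : SecrecyAchievable μ a N₀ N₁ N₂ R) : R ≤ mainCapacity μ a N₁ := by
  have hlog2 : 0 < Real.log 2 := Real.log_pos one_lt_two
  have key : ∀ ε : ℝ, 0 < ε → ε < 1 → (1 - ε) * (R - ε) ≤ mainCapacity μ a N₁ + ε := by
    intro ε hε hε1
    obtain ⟨n₀, hn₀⟩ := hR ε hε
    -- Blocks longer than `m` absorb the additive constant `1 / log 2` of the converse into `n * ε`.
    obtain ⟨m, hm⟩ := exists_nat_gt (1 / Real.log 2 / ε)
    set n := max n₀ m
    obtain ⟨M, hM, c, h1, h2, -⟩ := hn₀ n (le_max_left _ _)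
    have hM1 : (1 : ℝ) ≤ M := by exact_mod_cast hM
    have hmn : (m : ℝ) ≤ n := by exact_mod_cast le_max_right n₀ m
    have hn : (0 : ℝ) < n := lt_of_lt_of_le (lt_trans (by positivity) hm) hmn
    have h3 := c.one_sub_errorProb_mul_logb_le hN₀ hN₁ ident₁ memoryless hM
    have h4 : (1 - ε) * Real.logb 2 M ≤ (1 - c.errorProb μ N₀ N₁) * Real.logb 2 M :=
      mul_le_mul_of_nonneg_right (by linarith) (Real.logb_nonneg one_lt_two hM1)
    have h5 : n * (R - ε) ≤ Real.logb 2 M := by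
      have : R - ε ≤ Real.logb 2 M / n := by linarith [(abs_le.1 h1).1]
      rwa [le_div_iff₀ hn, mul_comm] at this
    have h6 : 1 / Real.log 2 ≤ n * ε := by
      rw [div_lt_iff₀ hε] at hm
      nlinarith
    have h7 : (1 - ε) * (n * (R - ε)) ≤ (1 - ε) * Real.logb 2 M :=
      mul_le_mul_of_nonneg_left h5 (by linarith)
    refine le_of_mul_le_mul_left ?_ hn
    linarith
  have hc : Filter.Tendsto (fun ε : ℝ => (1 - ε) * (R - ε) - ε) (nhdsWithin 0 (Set.Ioi 0))
      (nhds R) := by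
    have : Continuous fun ε : ℝ => (1 - ε) * (R - ε) - ε := by fun_prop
    simpa using (this.tendsto 0).mono_left nhdsWithin_le_nhds
  refine le_of_tendsto hc ?_
  filter_upwards [Ioo_mem_nhdsGT (one_pos : (0 : ℝ) < 1)] with ε hε
  linarith [key ε hε.1 hε.2]

/-- A nonnegative rate below the capacity is achievable over the main channel. -/
theorem mainAchievable_of_lt_mainCapacity (ha : 0 < a) (hN₁ : ∀ i, Measurable (N₁ i))
    (indep₁ : iIndepFun N₁ μ) (ident₁ : ∀ i, IdentDistrib (N₁ i) (N₁ 0) μ μ) {R : ℝ} (hR0 : 0 ≤ R)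
    (hR : R < mainCapacity μ a N₁) : MainAchievable μ a N₁ R := by
  have hne : (stdSimplex ℝ (Fin a)).Nonempty := ⟨_, single_mem_stdSimplex ℝ ⟨0, ha⟩⟩
  obtain ⟨_, ⟨p, hp, rfl⟩, hlt⟩ :=
    exists_lt_of_lt_csSup (hne.image _) hR
  exact mainAchievable_of_lt_mutualInfo hN₁ indep₁ ident₁ p hp R hR0 hlt

/-- Since zero belongs to `S`, every upper bound is nonnegative, so achievability of nonnegative
rates is enough. -/
theorem isLUB_of_forall_lt {S : Set ℝ} {C : ℝ} (h0 : (0 : ℝ) ∈ S) (hS : ∀ R, 0 ≤ R → R < C → R ∈ S)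
    (hC : ∀ R ∈ S, R ≤ C) : IsLUB S C := by
  refine ⟨hC, fun b hb => ?_⟩
  by_contra! h
  obtain ⟨R, h1, h2⟩ := exists_between h
  exact (hb (hS R ((hb h0).trans h1.le) h2)).not_gt h1

end ModWiretap

theorem theorem2 {Ω : Type*} [MeasurableSpace Ω] (μ : Measure Ω) [IsProbabilityMeasure μ]
    (a q₀ q₁ q₂ : ℕ) (ha : 0 < a)
    (N₀ : ℕ → Ω → Fin q₀) (N₁ : ℕ → Ω → Fin q₁) (N₂ : ℕ → Ω → Fin q₂)
    (hN₀ : ∀ i, Measurable (N₀ i)) (hN₁ : ∀ i, Measurable (N₁ i)) (hN₂ : ∀ i, Measurable (N₂ i))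
    -- each of the noise processes at the two receivers is i.i.d.; they may depend on each other
    (indep₁ : iIndepFun N₁ μ) (ident₁ : ∀ i, IdentDistrib (N₁ i) (N₁ 0) μ μ)
    (indep₂ : iIndepFun N₂ μ) (ident₂ : ∀ i, IdentDistrib (N₂ i) (N₂ 0) μ μ)
    -- the main channel is memoryless, also given the past noise on the feedback signal
    (memoryless : ∀ i : ℕ,
      IndepFun (N₁ i) (fun ω => fun j : Fin i => (N₀ j ω, N₁ j ω)) μ) :
    IsLUB {R : ℝ | ModWiretap.SecrecyAchievable μ a N₀ N₁ N₂ R}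
        (ModWiretap.mainCapacity μ a N₁) ∧
      IsLUB {R : ℝ | ModWiretap.MainAchievable μ a N₁ R}
        (ModWiretap.mainCapacity μ a N₁) := by
  have hMS : ∀ R, ModWiretap.MainAchievable μ a N₁ R →
      ModWiretap.SecrecyAchievable μ a N₀ N₁ N₂ R := fun R h =>
    ModWiretap.secrecyAchievable_of_mainAchievable ha N₀ N₁ N₂ hN₁ hN₂ h
  have hS : ∀ R, ModWiretap.SecrecyAchievable μ a N₀ N₁ N₂ R →
      R ≤ ModWiretap.mainCapacity μ a N₁ := fun R h =>
    h.le_mainCapacity hN₀ hN₁ ident₁ memoryless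
  have h0 : ModWiretap.MainAchievable μ a N₁ 0 := ModWiretap.mainAchievable_zero ha
  have hM := fun R (hR0 : 0 ≤ R) (hR : R < ModWiretap.mainCapacity μ a N₁) =>
    ModWiretap.mainAchievable_of_lt_mainCapacity ha hN₁ indep₁ ident₁ hR0 hR
  exact ⟨ModWiretap.isLUB_of_forall_lt (hMS 0 h0) (fun R hR0 hR => hMS R (hM R hR0 hR)) hS,
    ModWiretap.isLUB_of_forall_lt h0 hM fun R h => hS R (hMS R h)⟩
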